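/- Let $M^n$ be a closed (compact, connected, without boundary) smooth Riemannian manifold whose fundamental group is non-trivial and torsion-free (no element other than the identity has finite order). Let $\operatorname{diam}(M^n)$ be the diameter of $M^n$ with respect to the Riemannian distance. Then for any two, not necessarily distinct, points $x,y\in M^n$ and every $k=1,2,3,\ldots$ there exist $k$ distinct geodesics $\gamma_1,\dots,\gamma_k:[0,1]\to M^n$ starting at $x$ and ending at $y$, each of length not exceeding $k\operatorname{diam}(M^n)$. (Geodesics are solutions of the geodesic equation $\nabla_{\gamma'}\gamma'=0$; constant paths count as geodesics.) Moreover, these geodesics can be chosen to be pairwise non-homotopic relative to their endpoints, with each $\gamma_i$ having the smallest length among all piecewise $C^1$ paths from $x$ to $y$ that are homotopic to $\gamma_i$ relative to the endpoints. -/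

import Mathlib

open Bundle
open scoped Manifold ContDiff

noncomputable section

namespace RiemannianGeodesic

/-- `chartMetric p z v w = g_z(v, w)`: the Riemannian metric of `M` read in the preferred chart
`φ = extChartAt 𝓘(ℝ, E) p` around `p`, that is, the inner product at `φ⁻¹ z` of the images of the
coordinate vectors `v` and `w` under `D(φ⁻¹)(z)`. It is meaningful for `z` in the (open) target
of `φ`. Below, `E` is the Euclidean space of dimension `n`. -/
def chartMetric {E : Type*} [NormedAddCommGroup E] [NormedSpace ℝ E]
    {M : Type*} [TopologicalSpace M] [ChartedSpace E M]
    [RiemannianBundle (fun q : M ↦ TangentSpace 𝓘(ℝ, E) q)]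
    (p : M) (z v w : E) : ℝ :=
  inner ℝ
    (mfderiv 𝓘(ℝ, E) 𝓘(ℝ, E) (extChartAt 𝓘(ℝ, E) p).symm z v)
    (mfderiv 𝓘(ℝ, E) 𝓘(ℝ, E) (extChartAt 𝓘(ℝ, E) p).symm z w)

/-- The Christoffel symbol of the first kind of the metric in the chart around `p`, evaluated on
coordinate vectors:
`Γ_z(v₁, v₂; w) = (∂_{v₁} g(v₂, w) + ∂_{v₂} g(v₁, w) - ∂_w g(v₁, v₂)) / 2` at `z`.
On basis vectors this is `Γ_{ij,l} = (∂_i g_{jl} + ∂_j g_{il} - ∂_l g_{ij}) / 2`. -/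
def christoffel {n : ℕ} {M : Type*} [TopologicalSpace M]
    [ChartedSpace (EuclideanSpace ℝ (Fin n)) M]
    [RiemannianBundle (fun q : M ↦ TangentSpace (𝓡 n) q)]
    (p : M) (z v₁ v₂ w : EuclideanSpace ℝ (Fin n)) : ℝ :=
  (fderiv ℝ (fun z' ↦ chartMetric p z' v₂ w) z v₁
    + fderiv ℝ (fun z' ↦ chartMetric p z' v₁ w) z v₂
    - fderiv ℝ (fun z' ↦ chartMetric p z' v₁ v₂) z w) / 2

/-- A path `γ : [0, 1] → M` is a geodesic if it is smooth and satisfies the geodesic equation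
`∇_{γ'} γ' = 0`. At time `t` the equation is written in the chart around `γ t`: with `u` the
coordinate expression of `γ`, it reads `g_u(u'', w) + Γ_u(u', u'; w) = 0` for all `w`, which is
`u''ᵏ + Γᵏ_{ij} u'ⁱ u'ʲ = 0` with the index `k` lowered by the metric. Geodesics are thus
parametrized proportionally to arc length, and constant paths are geodesics. -/
def IsGeodesic {n : ℕ} {M : Type*} [TopologicalSpace M]
    [ChartedSpace (EuclideanSpace ℝ (Fin n)) M]
    [RiemannianBundle (fun q : M ↦ TangentSpace (𝓡 n) q)]
    {x y : M} (γ : Path x y) : Prop :=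
  ContMDiffOn 𝓘(ℝ, ℝ) (𝓡 n) ∞ γ.extend (Set.Icc 0 1) ∧
  ∀ t ∈ Set.Ioo (0 : ℝ) 1, ∀ w : EuclideanSpace ℝ (Fin n),
    let u : ℝ → EuclideanSpace ℝ (Fin n) := fun s ↦ extChartAt (𝓡 n) (γ.extend t) (γ.extend s)
    chartMetric (γ.extend t) (u t) (deriv (deriv u) t) w
      + christoffel (γ.extend t) (u t) (deriv u t) (deriv u t) w = 0

/-- The Riemannian length `∫₀¹ ‖γ'(t)‖ dt` of a (piecewise `C¹`) path. -/
def length {n : ℕ} {M : Type*} [TopologicalSpace M]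
    [ChartedSpace (EuclideanSpace ℝ (Fin n)) M]
    [RiemannianBundle (fun q : M ↦ TangentSpace (𝓡 n) q)]
    {x y : M} (γ : Path x y) : ENNReal :=
  Manifold.pathELength (𝓡 n) γ.extend 0 1

/-- A path is piecewise `C¹` if `[0, 1]` has a finite subdivision such that the path is `C¹` on
each of the closed intervals of the subdivision. -/
def IsPiecewiseC1 {n : ℕ} {M : Type*} [TopologicalSpace M]
    [ChartedSpace (EuclideanSpace ℝ (Fin n)) M] {x y : M} (γ : Path x y) : Prop :=
  ∃ (m : ℕ) (t : Fin (m + 1) → ℝ), Monotone t ∧ t 0 = 0 ∧ t (Fin.last m) = 1 ∧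
    ∀ i : Fin m,
      ContMDiffOn 𝓘(ℝ, ℝ) (𝓡 n) 1 γ.extend (Set.Icc (t i.castSucc) (t i.succ))

/-- `γ` has the smallest length among the piecewise `C¹` paths that are homotopic to `γ` with
fixed endpoints. -/
def MinimizesLengthInHomotopyClass {n : ℕ} {M : Type*} [TopologicalSpace M]
    [ChartedSpace (EuclideanSpace ℝ (Fin n)) M]
    [RiemannianBundle (fun q : M ↦ TangentSpace (𝓡 n) q)]
    {x y : M} (γ : Path x y) : Prop :=
  ∀ c : Path x y, IsPiecewiseC1 (n := n) c → c.Homotopic γ →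
    length (n := n) γ ≤ length (n := n) c

end RiemannianGeodesic

end

/-! Write D for the diameter. The fundamental group at x contains a non-trivial class a of length at
most 2D. Indeed, fix shortest paths c_z from x to all points z and cut a loop into small arcs: it
becomes a product of loops c_z · (small arc) · c_w⁻¹, each of length barely above 2D. If all classes
of length at most 2D were trivial, compactness would extend this to 2D + ε, and every loop would be
trivial (`exists_ne_refl_lengthLE`).

The group is torsion-free, so the powers of a are distinct. For k = 2m + 1 take a^j e with |j| ≤ m,
where e is a shortest path from x to y; the length is at most 2mD + D. For k = 2m this construction
is too long by D. Instead, split a = BC at the midpoint w of a loop representing it, and let e be a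
shortest path from w to y. The class a^j B e is also a^(j+1) C⁻¹ e; the first form gives the bound
2mD for 0 ≤ j < m, the second for -m ≤ j < 0 (`exists_injective_lengthLE`).

Lengths of classes are measured by Lipschitz constants of paths on the unit interval. Arzelà-Ascoli,
together with the fact that uniformly close paths are homotopic, yields in each class a path with
the least constant ℓ (`exists_minimal_lipschitzWith`). It is a priori only Lipschitz. In a chart its
speed is at most ℓ, while every competing arc has length at least ℓ times the elapsed time; by
Cauchy-Schwarz it minimizes the energy. The first variation and the lemma of du Bois-Reymond give an
integrated Euler-Lagrange equation (`exists_ae_momentum_eq`); solving it for the velocity and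
bootstrapping gives smoothness and the geodesic equation
(`contDiffOn_and_geodesic_of_ae_momentum_eq`). The passage between the distance of M and the metric
in a chart rests on `sqrt_chartForm_le_of_eventually_dist_le` and `edist_chart_symm_le_lintegral`.
-/

namespace RiemannianGeodesic

open Set Filter Topology
open scoped unitInterval NNReal ENNReal

/-! ### Lipschitz paths and the length of a homotopy class -/

section MetricPaths

variable {X : Type*} [MetricSpace X] {x y z : X}

/-- A path whose increments are dominated by those of a continuous function `φ` can be
reparametrized to be Lipschitz, with a constant arbitrarily close to the variation of `φ`. -/
lemma exists_homotopic_lipschitzWith (γ : Path x y) (φ : I → ℝ) (hφ : Continuous φ)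
    (h : ∀ s t : I, s ≤ t → dist (γ s) (γ t) ≤ φ t - φ s) {L δ : ℝ≥0}
    (hL : φ 1 - φ 0 ≤ L) (hδ : 0 < δ) :
    ∃ γ' : Path x y, γ'.Homotopic γ ∧ LipschitzWith (L + δ) γ' := by
  have hmono : ∀ s t : I, s ≤ t → φ s ≤ φ t := fun s t hst ↦
    sub_nonneg.1 (dist_nonneg.trans (h s t hst))
  have hδ' : (0 : ℝ) < δ := hδ
  -- The extra term `δ * t` makes the clock `ψ` strictly increasing, hence invertible, even where
  -- `φ` is constant.
  set T : ℝ := φ 1 - φ 0 + δ with hT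
  have hTpos : 0 < T := by
    have := hmono 0 1 zero_le_one
    linarith
  have h01 : ∀ t : I, (φ t - φ 0 + δ * t) / T ∈ I := fun t ↦ by
    have h0 := hmono 0 t t.2.1
    have h1 := hmono t 1 t.2.2
    have h2 := mul_nonneg hδ'.le t.2.1
    have h3 := mul_le_mul_of_nonneg_left t.2.2 hδ'.le
    refine ⟨div_nonneg (by linarith) hTpos.le, (div_le_one hTpos).2 (by linarith)⟩
  let ψ : I → I := fun t ↦ ⟨(φ t - φ 0 + δ * t) / T, h01 t⟩
  have ψcont : Continuous ψ := by
    refine Continuous.subtype_mk ?_ _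
    fun_prop
  have ψ0 : ψ 0 = 0 := by ext; simp [ψ]
  have ψ1 : ψ 1 = 1 := by ext; simp [ψ, ← hT, hTpos.ne']
  have ψmono : StrictMono ψ := fun s t hst ↦ by
    have h0 := hmono s t hst.le
    have h1 : (s : ℝ) < t := hst
    change (φ s - φ 0 + δ * s) / T < (φ t - φ 0 + δ * t) / T
    have := mul_lt_mul_of_pos_left h1 hδ'
    gcongr ?_ / T
    linarith
  have ψsurj : Function.Surjective ψ := fun c ↦ by
    have := intermediate_value_univ 0 1 ψcont
    rw [ψ0, ψ1] at this
    exact this ⟨c.2.1, c.2.2⟩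
  let e : I ≃o I := ψmono.orderIsoOfSurjective ψ ψsurj
  have he : ∀ t, ψ (e.symm t) = t := fun t ↦ e.apply_symm_apply t
  have e0 : e.symm 0 = 0 := ψmono.injective (by rw [he, ψ0])
  have e1 : e.symm 1 = 1 := ψmono.injective (by rw [he, ψ1])
  have econt : Continuous (fun t ↦ e.symm t) := e.symm.continuous
  refine ⟨γ.reparam _ econt e0 e1, ⟨(Path.Homotopy.reparam γ _ econt e0 e1).symm⟩, ?_⟩
  have key : ∀ s t : I, s ≤ t →
      dist (γ (e.symm s)) (γ (e.symm t)) ≤ T * (t - s) := fun s t hst ↦ by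
    have hle : e.symm s ≤ e.symm t := e.symm.monotone hst
    refine (h _ _ hle).trans ?_
    have h1 : (t : ℝ) = _ := congrArg Subtype.val (he t).symm
    have h2 : (s : ℝ) = _ := congrArg Subtype.val (he s).symm
    rw [h1, h2]
    simp only [ψ]
    rw [← sub_div, mul_div_cancel₀ _ hTpos.ne']
    have : (e.symm s : ℝ) ≤ e.symm t := hle
    have := mul_le_mul_of_nonneg_left this hδ'.le
    linarith
  have hTL : T ≤ ((L + δ : ℝ≥0) : ℝ) := by push_cast; linarith
  refine LipschitzWith.of_dist_le_mul fun s t ↦ ?_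
  simp only [Path.coe_reparam, Function.comp_apply]
  rcases le_total s t with hst | hst
  · refine (key s t hst).trans ?_
    rw [Subtype.dist_eq, dist_comm, Real.dist_eq,
      abs_of_nonneg (sub_nonneg.2 (Subtype.coe_le_coe.2 hst))]
    exact mul_le_mul_of_nonneg_right hTL (sub_nonneg.2 (Subtype.coe_le_coe.2 hst))
  · rw [dist_comm]
    refine (key t s hst).trans ?_
    rw [Subtype.dist_eq, Real.dist_eq, abs_of_nonneg (sub_nonneg.2 (Subtype.coe_le_coe.2 hst))]
    exact mul_le_mul_of_nonneg_right hTL (sub_nonneg.2 (Subtype.coe_le_coe.2 hst))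

/-- A homotopy class of paths has length at most `L` if it contains `(L + δ)`-Lipschitz paths
for all `δ > 0`. -/
def LengthLE (A : Path.Homotopic.Quotient x y) (L : ℝ≥0) : Prop :=
  ∀ δ : ℝ≥0, 0 < δ → ∃ γ : Path x y, Path.Homotopic.Quotient.mk γ = A ∧ LipschitzWith (L + δ) γ

lemma LengthLE.mono {A : Path.Homotopic.Quotient x y} {L L' : ℝ≥0} (h : LengthLE A L)
    (hL : L ≤ L') : LengthLE A L' := fun δ hδ ↦ by
  obtain ⟨γ, h1, h2⟩ := h δ hδ
  exact ⟨γ, h1, h2.weaken (by gcongr)⟩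

lemma LengthLE.of_lipschitzWith {γ : Path x y} {L : ℝ≥0} (h : LipschitzWith L γ) :
    LengthLE (Path.Homotopic.Quotient.mk γ) L := fun _ _ ↦
  ⟨γ, rfl, h.weaken le_self_add⟩

lemma LengthLE.refl (x : X) : LengthLE (Path.Homotopic.Quotient.refl x) 0 := fun δ _ ↦
  ⟨Path.refl x, rfl, (LipschitzWith.const x).weaken (by simp)⟩

lemma LengthLE.symm {A : Path.Homotopic.Quotient x y} {L : ℝ≥0} (h : LengthLE A L) :
    LengthLE A.symm L := fun δ hδ ↦ by
  obtain ⟨γ, h1, h2⟩ := h δ hδ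
  refine ⟨γ.symm, by rw [Path.Homotopic.Quotient.mk_symm, h1], ?_⟩
  refine LipschitzWith.of_dist_le_mul fun s t ↦ ?_
  refine (h2.dist_le_mul _ _).trans (le_of_eq ?_)
  congr 1
  simp only [Subtype.dist_eq, unitInterval.coe_symm_eq, Real.dist_eq]
  rw [abs_sub_comm]
  ring_nf

/-- Concatenation doubles the speed on each half, so its own Lipschitz constant is twice the maximum
rather than the sum. Running it by the clock `φ`, which grows by `K` on the first half and by `K'`
on the second, restores the sum. The slack splits as δ/4 + δ/4 + δ/2. -/
lemma LengthLE.trans {A : Path.Homotopic.Quotient x y} {B : Path.Homotopic.Quotient y z}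
    {L L' : ℝ≥0} (hA : LengthLE A L) (hB : LengthLE B L') : LengthLE (A.trans B) (L + L') := by
  intro δ hδ
  obtain ⟨γ, rfl, hγ⟩ := hA (δ / 4) (by positivity)
  obtain ⟨η, rfl, hη⟩ := hB (δ / 4) (by positivity)
  set K := L + δ / 4
  set K' := L' + δ / 4
  let φ : I → ℝ := fun t ↦ K * min (2 * (t : ℝ)) 1 + K' * max (2 * (t : ℝ) - 1) 0
  have key : ∀ s t : I, s ≤ t → dist (γ.trans η s) (γ.trans η t) ≤ φ t - φ s := by
    intro s t hst
    have hs0 := s.2.1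
    have ht1 := t.2.2
    have hst' : (s : ℝ) ≤ t := hst
    have hγ' := fun a b ↦ hγ.dist_le_mul a b
    have hη' := fun a b ↦ hη.dist_le_mul a b
    have hK : (0 : ℝ) ≤ K := K.2
    have hK' : (0 : ℝ) ≤ K' := K'.2
    simp only [Path.trans_apply, φ]
    split_ifs with h1 h2 h2
    · rw [min_eq_left (by linarith), max_eq_right (by linarith), min_eq_left (by linarith),
        max_eq_right (by linarith)]
      refine (hγ' _ _).trans (le_of_eq ?_)
      rw [Subtype.dist_eq, dist_comm, Real.dist_eq, abs_of_nonneg (by linarith)]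
      ring
    · rw [min_eq_right (by linarith), max_eq_left (by linarith), min_eq_left (by linarith),
        max_eq_right (by linarith)]
      refine (dist_triangle _ y _).trans ?_
      have e1 : y = γ 1 := γ.target.symm
      have e2 : y = η 0 := η.source.symm
      have h3 := hγ' ⟨2 * (s : ℝ), by constructor <;> linarith⟩ 1
      have h4 := hη' 0 ⟨2 * (t : ℝ) - 1, by constructor <;> linarith⟩
      rw [← e1, Subtype.dist_eq, dist_comm (_ : ℝ), Real.dist_eq,
        abs_of_nonneg (by simp only [Set.Icc.coe_one]; linarith)] at h3
      rw [← e2, Subtype.dist_eq, dist_comm (_ : ℝ), Real.dist_eq,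
        abs_of_nonneg (by simp only [Set.Icc.coe_zero]; linarith)] at h4
      simp only [Set.Icc.coe_one, Set.Icc.coe_zero] at h3 h4
      linarith
    · exact absurd (hst'.trans h2) h1
    · rw [min_eq_right (by linarith), max_eq_left (by linarith), min_eq_right (by linarith),
        max_eq_left (by linarith)]
      refine (hη' _ _).trans (le_of_eq ?_)
      rw [Subtype.dist_eq, dist_comm, Real.dist_eq, abs_of_nonneg (by linarith)]
      ring
  obtain ⟨ζ, hζ, hζL⟩ := exists_homotopic_lipschitzWith (γ.trans η) φ
    (by fun_prop) (L := K + K') (δ := δ / 2) key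
    (by simp only [φ, Set.Icc.coe_one, Set.Icc.coe_zero]; norm_num) (by positivity)
  refine ⟨ζ, ?_, hζL.weaken (le_of_eq ?_)⟩
  · rw [← Path.Homotopic.Quotient.mk_trans]
    exact Path.Homotopic.Quotient.eq.2 hζ
  · apply NNReal.eq
    simp only [K, K']
    push_cast
    ring

/-- The restriction of a Lipschitz path to a subinterval. -/
lemma LengthLE.subpath {γ : Path x y} {K : ℝ≥0} (h : LipschitzWith K γ) {s t : I} {L : ℝ≥0}
    (hst : s ≤ t) (hL : K * (t - s : ℝ) ≤ L) :
    LengthLE (Path.Homotopic.Quotient.mk (γ.subpath s t)) L := by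
  refine LengthLE.of_lipschitzWith (LipschitzWith.of_dist_le_mul fun a b ↦ ?_)
  refine (h.dist_le_mul _ _).trans ?_
  have : dist (Set.Icc.convexComb s t a) (Set.Icc.convexComb s t b) = (t - s : ℝ) * dist a b := by
    rw [Subtype.dist_eq, Subtype.dist_eq, Real.dist_eq, Real.dist_eq,
      ← abs_of_nonneg (sub_nonneg.2 (show (s : ℝ) ≤ t from hst)), ← abs_mul]
    simp only [Set.Icc.coe_convexComb]
    congr 1
    ring
  rw [this, ← mul_assoc]
  gcongr

lemma mk_subpath_trans (γ : Path x y) (s t u : I) :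
    (Path.Homotopic.Quotient.mk (γ.subpath s t)).trans
      (Path.Homotopic.Quotient.mk (γ.subpath t u)) =
      Path.Homotopic.Quotient.mk (γ.subpath s u) := by
  rw [← Path.Homotopic.Quotient.mk_trans]
  exact Path.Homotopic.Quotient.eq.2 ⟨Path.Homotopy.subpathTransSubpath γ s t u⟩

end MetricPaths

end RiemannianGeodesic

namespace RiemannianGeodesic

open Set Filter Topology
open scoped unitInterval NNReal ENNReal

/-! ### Homotopy of close paths, compactness, and a short non-trivial loop -/

section MetricPaths

variable {X : Type*} [MetricSpace X] {x y z : X}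

/-- Any two paths with the same endpoints inside a common ball of radius `r` are homotopic. -/
def SmallPathsHomotopic (X : Type*) [MetricSpace X] (r : ℝ) : Prop :=
  ∀ (p x y : X) (γ η : Path x y), (∀ t, γ t ∈ Metric.ball p r) → (∀ t, η t ∈ Metric.ball p r) →
    γ.Homotopic η

/-- Any two points are joined by Lipschitz paths with constant close to their distance. -/
def HasShortPaths (X : Type*) [MetricSpace X] : Prop :=
  ∀ (x y : X) (δ : ℝ≥0), 0 < δ → ∃ γ : Path x y, LipschitzWith (nndist x y + δ) γ

lemma LipschitzWith.dist_source_le {γ : Path x y} {K : ℝ≥0} (h : LipschitzWith K γ) (t : I) :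
    dist (γ t) x ≤ K := by
  have := h.dist_le_mul t 0
  rw [γ.source, Subtype.dist_eq, Real.dist_eq, Set.Icc.coe_zero, sub_zero,
    abs_of_nonneg t.2.1] at this
  exact this.trans (mul_le_of_le_one_right K.2 t.2.2)

/-- Walks along the points i / (N + 1) with mesh below `ε`; it replaces explicit subdivisions of
paths. -/
lemma unitInterval_induction {P : I → Prop} (h0 : P 0) {ε : ℝ} (hε : 0 < ε)
    (hstep : ∀ s t : I, s ≤ t → dist s t < ε → P s → P t) : P 1 := by
  obtain ⟨N, hN⟩ := exists_nat_one_div_lt hε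
  have hN0 : (0 : ℝ) < N + 1 := by positivity
  have key : ∀ i : ℕ, i ≤ N + 1 → P (projIcc 0 1 zero_le_one ((i : ℝ) / (N + 1))) := by
    intro i
    induction i with
    | zero => intro _; simpa using h0
    | succ i ih =>
      intro hi
      have hi' : ((i : ℝ) + 1) ≤ N + 1 := by exact_mod_cast hi
      refine hstep _ _ ?_ ?_ (ih (by omega))
      · apply monotone_projIcc
        gcongr
        linarith
      · have h1 : (i : ℝ) / (N + 1) ∈ I := ⟨by positivity, (div_le_one hN0).2 (by linarith)⟩
        have h2 : ((i + 1 : ℕ) : ℝ) / (N + 1) ∈ I :=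
          ⟨by positivity, (div_le_one hN0).2 (by push_cast; linarith)⟩
        rw [projIcc_of_mem _ h1, projIcc_of_mem _ h2, Subtype.dist_eq, dist_comm, Real.dist_eq,
          ← sub_div]
        push_cast
        rw [add_sub_cancel_left, abs_of_pos (by positivity)]
        exact hN
  have := key (N + 1) le_rfl
  push_cast at this
  rw [div_self hN0.ne'] at this
  simpa using this

/-- The subpath from 0 to 1 has endpoints `γ 0` and `γ 1`, which equal `x` and `y` only
propositionally. This lemma and `quotient_of_cast` absorb the transport. -/
lemma homotopic_of_cast {a b a' b' : X} {γ η : Path x y} (ha : a = x) (hb : b = y) (ha' : a' = x)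
    (hb' : b' = y)
    (h : (Path.Homotopic.Quotient.mk (γ.cast ha hb)).trans
        (Path.Homotopic.Quotient.mk ((Path.refl y).cast hb hb')) =
      (Path.Homotopic.Quotient.mk ((Path.refl x).cast ha ha')).trans
        (Path.Homotopic.Quotient.mk (η.cast ha' hb'))) : γ.Homotopic η := by
  subst ha hb ha' hb'
  refine Path.Homotopic.Quotient.eq.1 ?_
  simpa using h

lemma exists_dist_lt_of_dist_lt (γ : Path x y) {ε : ℝ} (hε : 0 < ε) :
    ∃ δ > 0, ∀ s t : I, dist s t < δ → dist (γ s) (γ t) < ε := by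
  obtain ⟨δ, hδ, h⟩ := Metric.uniformContinuous_iff.1
    (CompactSpace.uniformContinuous_of_continuous γ.continuous) ε hε
  exact ⟨δ, hδ, fun s t hst ↦ h hst⟩

lemma subpath_mem_ball {γ : Path x y} {s t : I} (hst : s ≤ t) {δ ε : ℝ}
    (h : ∀ a b : I, dist a b < δ → dist (γ a) (γ b) < ε) (hδ : dist s t < δ) (a : I) :
    dist (γ.subpath s t a) (γ s) < ε := by
  have : γ.subpath s t a ∈ range (γ.subpath s t) := mem_range_self a
  rw [Path.range_subpath_of_le _ _ _ hst] at this
  obtain ⟨b, hb, hb'⟩ := this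
  rw [← hb']
  refine h _ _ (lt_of_le_of_lt ?_ hδ)
  have h1 : (s : ℝ) ≤ b := hb.1
  have h2 : (b : ℝ) ≤ t := hb.2
  rw [Subtype.dist_eq, dist_comm s, Subtype.dist_eq, Real.dist_eq, Real.dist_eq,
    abs_of_nonneg (by linarith), abs_of_nonneg (by linarith)]
  linarith

/-- Uniformly close paths with the same endpoints are homotopic. -/
lemma homotopic_of_dist_lt {r : ℝ} (hr : 0 < r) (hS : SmallPathsHomotopic X r)
    (hL : HasShortPaths X) {γ η : Path x y} (h : ∀ t, dist (γ t) (η t) < r / 4) :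
    γ.Homotopic η := by
  obtain ⟨δ₁, hδ₁, hγ⟩ := exists_dist_lt_of_dist_lt γ (show 0 < r / 4 by positivity)
  obtain ⟨δ₂, hδ₂, hη⟩ := exists_dist_lt_of_dist_lt η (show 0 < r / 4 by positivity)
  have hshort : ∀ t, ∃ c : Path (γ t) (η t), ∀ s, dist (c s) (γ t) < r / 4 := fun t ↦ by
    obtain ⟨δ, hδ, hδ'⟩ : ∃ δ : ℝ≥0, 0 < δ ∧ dist (γ t) (η t) + δ < r / 4 := by
      refine ⟨⟨(r / 4 - dist (γ t) (η t)) / 2, by linarith [h t]⟩, ?_, ?_⟩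
      · exact half_pos (sub_pos.2 (h t))
      · change dist (γ t) (η t) + (r / 4 - dist (γ t) (η t)) / 2 < r / 4
        linarith [h t]
    obtain ⟨c, hc⟩ := hL (γ t) (η t) δ hδ
    refine ⟨c, fun s ↦ (LipschitzWith.dist_source_le hc s).trans_lt ?_⟩
    simpa using hδ'
  let c₀ : Path (γ 0) (η 0) := (Path.refl x).cast γ.source η.source
  -- A ladder between the two paths: the rung at time t is a path from `γ t` to `η t` staying within
  -- r/4 of `γ t`, and the region of the ladder below it commutes up to homotopy.
  have key : ∃ c : Path (γ 1) (η 1), (∀ s, dist (c s) (γ 1) < r / 4) ∧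
      (Path.Homotopic.Quotient.mk (γ.subpath 0 1)).trans (Path.Homotopic.Quotient.mk c) =
      (Path.Homotopic.Quotient.mk c₀).trans (Path.Homotopic.Quotient.mk (η.subpath 0 1)) := by
    refine unitInterval_induction (P := fun t ↦ ∃ c : Path (γ t) (η t),
      (∀ s, dist (c s) (γ t) < r / 4) ∧
      (Path.Homotopic.Quotient.mk (γ.subpath 0 t)).trans (Path.Homotopic.Quotient.mk c) =
      (Path.Homotopic.Quotient.mk c₀).trans (Path.Homotopic.Quotient.mk (η.subpath 0 t)))
      ?_ (lt_min hδ₁ hδ₂) ?_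
    · refine ⟨c₀, fun s ↦ ?_, by simp⟩
      simpa [c₀] using hr
    · rintro s t hst hd ⟨c, hc, hc'⟩
      obtain ⟨c', hc''⟩ := hshort t
      refine ⟨c', hc'', ?_⟩
      have h1 := subpath_mem_ball hst hγ (hd.trans_le (min_le_left _ _))
      have h2 := subpath_mem_ball hst hη (hd.trans_le (min_le_right _ _))
      have h3 := hγ s t (hd.trans_le (min_le_left _ _))
      -- All four sides of the cell stay within r/2 of `γ s`.
      have hsq : ((γ.subpath s t).trans c').Homotopic (c.trans (η.subpath s t)) := by
        refine hS (γ s) _ _ _ _ (fun a ↦ ?_) (fun a ↦ ?_)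
        · have : (γ.subpath s t).trans c' a ∈ range ((γ.subpath s t).trans c') := mem_range_self a
          rw [Path.trans_range] at this
          rcases this with ⟨b, hb⟩ | ⟨b, hb⟩
          · rw [← hb, Metric.mem_ball]
            linarith [h1 b]
          · rw [← hb, Metric.mem_ball]
            linarith [hc'' b, dist_triangle (c' b) (γ t) (γ s), dist_comm (γ s) (γ t)]
        · have : c.trans (η.subpath s t) a ∈ range (c.trans (η.subpath s t)) := mem_range_self a
          rw [Path.trans_range] at this
          rcases this with ⟨b, hb⟩ | ⟨b, hb⟩
          · rw [← hb, Metric.mem_ball]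
            linarith [hc b]
          · rw [← hb, Metric.mem_ball]
            linarith [h2 b, dist_triangle (η.subpath s t b) (η s) (γ s), h s,
              dist_comm (γ s) (η s)]
      have hsq' := Path.Homotopic.Quotient.eq.2 hsq
      rw [Path.Homotopic.Quotient.mk_trans, Path.Homotopic.Quotient.mk_trans] at hsq'
      rw [← mk_subpath_trans γ 0 s t, Path.Homotopic.Quotient.trans_assoc, hsq',
        ← Path.Homotopic.Quotient.trans_assoc, hc', Path.Homotopic.Quotient.trans_assoc,
        mk_subpath_trans]
  obtain ⟨c, hc, hc'⟩ := key
  have : c.Homotopic ((Path.refl y).cast γ.target η.target) := by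
    refine hS (γ 1) _ _ _ _ (fun a ↦ ?_) (fun a ↦ ?_)
    · rw [Metric.mem_ball]
      linarith [hc a]
    · simpa using hr
  rw [Path.Homotopic.Quotient.eq.2 this, Path.subpath_zero_one, Path.subpath_zero_one] at hc'
  exact homotopic_of_cast _ _ _ _ hc'

lemma quotient_of_cast {Q : ∀ x y : X, Path.Homotopic.Quotient x y → Prop} {a b : X}
    {γ : Path x y} (ha : a = x) (hb : b = y)
    (h : Q a b (Path.Homotopic.Quotient.mk (γ.cast ha hb))) :
    Q x y (Path.Homotopic.Quotient.mk γ) := by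
  subst ha hb
  exact h

/-- Homotopy classes of paths are products of classes of small paths. -/
lemma quotient_induction {Q : ∀ x y : X, Path.Homotopic.Quotient x y → Prop} {ε : ℝ} (hε : 0 < ε)
    (hrefl : ∀ x, Q x x (.refl x))
    (hstep : ∀ (x y z : X) (A : Path.Homotopic.Quotient x y) (γ : Path y z),
      (∀ t, dist (γ t) y < ε) → Q x y A → Q x z (A.trans (.mk γ)))
    (A : Path.Homotopic.Quotient x y) : Q x y A := by
  induction A with | mk γ =>
  obtain ⟨δ, hδ, hγ⟩ := exists_dist_lt_of_dist_lt γ hε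
  have : Q _ _ (.mk (γ.subpath 0 1)) := by
    refine unitInterval_induction (P := fun t ↦ Q _ _ (.mk (γ.subpath 0 t))) ?_ hδ ?_
    · simpa using hrefl _
    · intro s t hst hd h
      rw [← mk_subpath_trans γ 0 s t]
      exact hstep _ _ _ _ _ (subpath_mem_ball hst hγ hd) h
  rw [Path.subpath_zero_one] at this
  exact quotient_of_cast _ _ this

/-- In a set of paths that is closed under homotopy, the infimum of the Lipschitz constants
is attained. -/
lemma exists_lipschitzWith_of_forall_lt [CompactSpace X] {r : ℝ} (hr : 0 < r)
    (hS : SmallPathsHomotopic X r) (hL : HasShortPaths X) {S : Set (Path x y)}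
    (hSc : ∀ γ η : Path x y, γ.Homotopic η → γ ∈ S → η ∈ S) {K : ℝ≥0}
    (h : ∀ δ : ℝ≥0, 0 < δ → ∃ γ ∈ S, LipschitzWith (K + δ) γ) :
    ∃ γ ∈ S, LipschitzWith K γ := by
  have h' : ∀ n : ℕ, ∃ γ ∈ S, LipschitzWith (K + 1 / ((n : ℝ≥0) + 1)) γ := fun n ↦
    h _ (by positivity)
  choose γ hγS hγL using h'
  let F : ℕ → BoundedContinuousFunction I X := fun n ↦
    BoundedContinuousFunction.mkOfCompact (γ n).toContinuousMap
  let A : Set (BoundedContinuousFunction I X) := {f | LipschitzWith (K + 1) f}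
  have hev : ∀ t : I, Continuous fun f : BoundedContinuousFunction I X ↦ f t := fun t ↦
    (BoundedContinuousFunction.lipschitz_eval_const t).continuous
  have hA : IsCompact A := by
    refine BoundedContinuousFunction.arzela_ascoli₁ A ?_ ?_
    · have : A = ⋂ (s : I) (t : I), {f | edist (f s) (f t) ≤ (K + 1 : ℝ≥0) * edist s t} := by
        ext f
        simp only [A, LipschitzWith, mem_ofPred_eq, mem_iInter]
      rw [this]
      exact isClosed_iInter fun s ↦ isClosed_iInter fun t ↦
        isClosed_le ((hev s).edist (hev t)) continuous_const
    · exact (LipschitzWith.uniformEquicontinuous _ (K + 1) fun f ↦ f.2).equicontinuous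
  have hFA : ∀ n, F n ∈ A := fun n ↦ by
    refine (hγL n).weaken ?_
    gcongr
    rw [div_le_one (by positivity)]
    simp
  obtain ⟨f, -, φ, hφ, hf⟩ := hA.tendsto_subseq hFA
  have hpt : ∀ t, Tendsto (fun n ↦ γ (φ n) t) atTop (𝓝 (f t)) := fun t ↦
    ((hev t).tendsto f).comp hf
  let η : Path x y := ⟨f.toContinuousMap,
    tendsto_nhds_unique (hpt 0) (by simp), tendsto_nhds_unique (hpt 1) (by simp)⟩
  have hη : ∀ t, η t = f t := fun t ↦ rfl
  -- A single member of the sequence within r/4 of the limit suffices to put the limit in `S`.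
  obtain ⟨n, hn⟩ := ((Metric.tendsto_nhds.1 hf) (r / 4) (by positivity)).exists
  refine ⟨η, hSc (γ (φ n)) η ?_ (hγS _), ?_⟩
  · refine homotopic_of_dist_lt hr hS hL fun t ↦ ?_
    rw [hη]
    exact (BoundedContinuousFunction.dist_coe_le_dist t).trans_lt hn
  · refine LipschitzWith.of_dist_le_mul fun s t ↦ ?_
    have h1 : Tendsto (fun n ↦ dist (γ (φ n) s) (γ (φ n) t)) atTop (𝓝 (dist (f s) (f t))) :=
      (hpt s).dist (hpt t)
    have h2 : Tendsto (fun n : ℕ ↦ ((K : ℝ) + 1 / ((φ n : ℝ) + 1)) * dist s t) atTop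
        (𝓝 ((K + 0) * dist s t)) :=
      ((tendsto_one_div_add_atTop_nhds_zero_nat.comp hφ.tendsto_atTop).const_add _).mul_const _
    rw [add_zero] at h2
    refine le_of_tendsto_of_tendsto' h1 h2 fun n ↦ ?_
    have := (hγL (φ n)).dist_le_mul s t
    push_cast at this
    exact this

lemma LengthLE.exists_lipschitzWith [CompactSpace X] {r : ℝ} (hr : 0 < r)
    (hS : SmallPathsHomotopic X r) (hL : HasShortPaths X) {A : Path.Homotopic.Quotient x y}
    {K : ℝ≥0} (h : LengthLE A K) :
    ∃ γ : Path x y, Path.Homotopic.Quotient.mk γ = A ∧ LipschitzWith K γ :=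
  exists_lipschitzWith_of_forall_lt hr hS hL (S := {γ | Path.Homotopic.Quotient.mk γ = A})
    (fun _ _ h h' ↦ (Path.Homotopic.Quotient.eq.2 h).symm.trans h') h

/-- An almost shortest path between the endpoints stays in the ball of radius `r` about `x` (`δ'` is
chosen for this), so it is homotopic to the given small path. -/
lemma LengthLE.of_small {r : ℝ} (hS : SmallPathsHomotopic X r) (hL : HasShortPaths X)
    {γ : Path x y} (h : ∀ t, dist (γ t) x < r) : LengthLE (.mk γ) (nndist x y) := by
  intro δ hδ
  have hr := h 1
  rw [γ.target, dist_comm] at hr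
  obtain ⟨δ', hδ', hδr⟩ : ∃ δ' : ℝ≥0, 0 < δ' ∧ dist x y + δ' < r :=
    ⟨⟨(r - dist x y) / 2, by linarith⟩, half_pos (sub_pos.2 hr), by
      change dist x y + (r - dist x y) / 2 < r
      linarith⟩
  obtain ⟨η, hη⟩ := hL x y (min δ δ') (lt_min hδ hδ')
  refine ⟨η, Path.Homotopic.Quotient.eq.2 (hS x _ _ _ _ (fun t ↦ ?_) h), hη.weaken ?_⟩
  · refine (LipschitzWith.dist_source_le hη t).trans_lt (lt_of_le_of_lt ?_ hδr)
    push_cast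
    gcongr
    exact min_le_right _ _
  · gcongr
    exact min_le_left _ _

lemma HasShortPaths.exists_lengthLE [CompactSpace X] {r : ℝ} (hr : 0 < r)
    (hS : SmallPathsHomotopic X r) (hL : HasShortPaths X) (x y : X) :
    ∃ A : Path.Homotopic.Quotient x y, LengthLE A (nndist x y) := by
  obtain ⟨γ, -, hγ⟩ := exists_lipschitzWith_of_forall_lt hr hS hL (S := (univ : Set (Path x y)))
    (fun _ _ _ _ ↦ mem_univ _) fun δ hδ ↦ by
      obtain ⟨γ, hγ⟩ := hL x y δ hδ
      exact ⟨γ, mem_univ _, hγ⟩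
  exact ⟨_, LengthLE.of_lipschitzWith hγ⟩

/-- A non-trivial fundamental group contains a non-trivial class of length at most twice the
diameter. -/
lemma exists_ne_refl_lengthLE [CompactSpace X] {r : ℝ} (hr : 0 < r)
    (hS : SmallPathsHomotopic X r) (hL : HasShortPaths X) {D : ℝ≥0}
    (hD : ∀ x y : X, nndist x y ≤ D) {x : X} (hx : ∃ a : Path.Homotopic.Quotient x x, a ≠ .refl x) :
    ∃ a : Path.Homotopic.Quotient x x, a ≠ .refl x ∧ LengthLE a (2 * D) := by
  by_contra! hcon
  -- Spectral gap: non-trivial loops with constants tending to 2D would have a non-trivial limit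
  -- with constant 2D, because non-triviality is a homotopy invariant condition.
  obtain ⟨ε, hε, hεa⟩ : ∃ ε : ℝ≥0, 0 < ε ∧
      ∀ a : Path.Homotopic.Quotient x x, LengthLE a (2 * D + ε) → a = .refl x := by
    by_contra! hcon'
    obtain ⟨γ, hγ, hγL⟩ := exists_lipschitzWith_of_forall_lt hr hS hL (K := 2 * D)
      (S := {γ : Path x x | Path.Homotopic.Quotient.mk γ ≠ .refl x})
      (fun γ η h h' ↦ by
        change Path.Homotopic.Quotient.mk η ≠ _
        rw [← Path.Homotopic.Quotient.eq.2 h]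
        exact h') fun δ hδ ↦ by
      obtain ⟨a, ha, ha'⟩ := hcon' (δ / 2) (by positivity)
      obtain ⟨γ, rfl, h2⟩ := ha (δ / 2) (by positivity)
      exact ⟨γ, ha', by rwa [add_assoc, add_halves] at h2⟩
    exact hcon _ hγ (LengthLE.of_lipschitzWith hγL)
  choose c hc using fun z ↦ hL.exists_lengthLE hr hS x z
  obtain ⟨a, ha⟩ := hx
  -- Transport along any class sends the chosen class `c y` to `c z`: each small arc, closed up
  -- through `c z` and `c w`, is a loop of length at most 2D + ε and hence trivial. For the loop `a`
  -- this forces triviality.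
  have key := quotient_induction (Q := fun y z A ↦ (c y).trans A = c z)
    (ε := min r ε) (lt_min hr hε) (fun y ↦ by simp) (fun y z w A γ hγ hA ↦ ?_) a
  · apply ha
    calc a = ((c x).symm.trans (c x)).trans a := by simp
      _ = .refl x := by rw [Path.Homotopic.Quotient.trans_assoc, key]; simp
  · have h1 : LengthLE (.mk γ) ε := by
      refine (LengthLE.of_small hS hL fun t ↦ (hγ t).trans_le (min_le_left _ _)).mono ?_
      have := (hγ 1).trans_le (min_le_right _ _)
      rw [γ.target, dist_comm] at this
      exact this.le
    have h2 : LengthLE (((c z).trans (.mk γ)).trans (c w).symm) (2 * D + ε) := by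
      refine (((hc z).trans h1).trans (hc w).symm).mono ?_
      calc nndist x z + ε + nndist x w ≤ D + ε + D := by gcongr <;> apply hD
        _ = _ := by ring
    have h3 := hεa _ h2
    rw [← Path.Homotopic.Quotient.trans_assoc, hA]
    calc (c z).trans (.mk γ)
        = (((c z).trans (.mk γ)).trans (c w).symm).trans (c w) := by
          simp [Path.Homotopic.Quotient.trans_assoc]
      _ = c w := by rw [h3]; simp

end MetricPaths

end RiemannianGeodesic

namespace RiemannianGeodesic

open Set Filter Topology
open scoped unitInterval NNReal ENNReal

/-! ### Powers of a short loop: k distinct short classes -/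

section FundamentalGroup

variable {X : Type*} [MetricSpace X] {x y z : X}

lemma LengthLE.pow {a : FundamentalGroup X x} {L : ℝ≥0} (h : LengthLE (x := x) (y := x) a L)
    (n : ℕ) : LengthLE (x := x) (y := x) (a ^ n) (n * L) := by
  induction n with
  | zero =>
    rw [pow_zero, FundamentalGroup.one_def]
    simpa using LengthLE.refl x
  | succ n ih =>
    -- The product of the fundamental group composes from right to left, so the extra factor `a` is
    -- traversed first.
    rw [pow_succ, FundamentalGroup.mul_def]
    refine (h.trans ih).mono (le_of_eq ?_)
    push_cast
    ring

lemma LengthLE.zpow {a : FundamentalGroup X x} {L : ℝ≥0} (h : LengthLE (x := x) (y := x) a L)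
    (n : ℤ) : LengthLE (x := x) (y := x) (a ^ n) (n.natAbs * L) := by
  obtain ⟨m, rfl | rfl⟩ := n.eq_nat_or_neg
  · rw [zpow_natCast]
    simpa using h.pow m
  · rw [zpow_neg, zpow_natCast, FundamentalGroup.inv_def]
    simpa using (h.pow m).symm

lemma quotient_trans_right_injective (B : Path.Homotopic.Quotient x y) :
    Function.Injective fun a : FundamentalGroup X x ↦
      Path.Homotopic.Quotient.trans (x₀ := x) (x₁ := x) a B := fun a b h ↦ by
  have := congrArg (fun C ↦ Path.Homotopic.Quotient.trans C B.symm) h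
  simpa [Path.Homotopic.Quotient.trans_assoc] using this

/-- In a compact space whose fundamental group is non-trivial and torsion-free, any two points are
joined by `k` classes of paths of length at most `k` times the diameter. -/
lemma exists_injective_lengthLE [CompactSpace X] {r : ℝ} (hr : 0 < r)
    (hS : SmallPathsHomotopic X r) (hL : HasShortPaths X) {D : ℝ≥0}
    (hD : ∀ x y : X, nndist x y ≤ D) (x y : X) [Nontrivial (FundamentalGroup X x)]
    (htf : ∀ g : FundamentalGroup X x, g ≠ 1 → ¬ IsOfFinOrder g) (k : ℕ) :
    ∃ A : Fin k → Path.Homotopic.Quotient x y, Function.Injective A ∧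
      ∀ i, LengthLE (A i) (k * D) := by
  obtain ⟨(a : FundamentalGroup X x), ha, haL⟩ :=
    exists_ne_refl_lengthLE hr hS hL hD (exists_ne (1 : FundamentalGroup X x))
  obtain ⟨γ, hγa, hγ⟩ := haL.exists_lipschitzWith hr hS hL
  have hinj : Function.Injective fun n : ℤ ↦ a ^ n :=
    injective_zpow_iff_not_isOfFinOrder.2 (htf a ha)
  obtain ⟨m, rfl | rfl⟩ := k.even_or_odd'
  -- Even case: cutting the loop at its midpoint gives two halves of length at most D.
  · let h : I := ⟨1 / 2, by norm_num, by norm_num⟩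
    have h0 : (0 : I) ≤ h := h.2.1
    have h1 : h ≤ (1 : I) := h.2.2
    have key : ∃ (w : X) (B : Path.Homotopic.Quotient x w) (C : Path.Homotopic.Quotient w x),
        LengthLE B D ∧ LengthLE C D ∧ B.trans C = a := by
      refine ⟨γ h, .mk ((γ.subpath 0 h).cast γ.source.symm rfl),
        .mk ((γ.subpath h 1).cast rfl γ.target.symm), ?_, ?_, ?_⟩
      · refine quotient_of_cast (Q := fun _ _ A ↦ LengthLE A D) γ.source rfl ?_
        refine LengthLE.subpath hγ h0 ?_
        push_cast
        simp only [h]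
        linarith
      · refine quotient_of_cast (Q := fun _ _ A ↦ LengthLE A D) rfl γ.target ?_
        refine LengthLE.subpath hγ h1 ?_
        push_cast
        simp only [h]
        linarith
      · have := mk_subpath_trans γ 0 h 1
        rw [Path.subpath_zero_one] at this
        rw [← hγa]
        have h3 : ∀ (u v : X) (hu : u = x) (hv : v = x) (p : Path u (γ h)) (q : Path (γ h) v),
            (Path.Homotopic.Quotient.mk p).trans (.mk q) = .mk (γ.cast hu hv) →
            (Path.Homotopic.Quotient.mk (p.cast hu.symm rfl)).trans (.mk (q.cast rfl hv.symm)) =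
              .mk γ := by
          rintro u v rfl rfl p q hpq
          exact hpq
        exact h3 _ _ _ _ _ _ this
    obtain ⟨w, B, C, hB, hC, hBC⟩ := key
    obtain ⟨e, he⟩ := hL.exists_lengthLE hr hS w y
    replace he := he.mono (hD w y)
    -- The exponents run from -m to m - 1.
    refine ⟨fun i ↦ Path.Homotopic.Quotient.trans (x₁ := x)
      (a ^ ((i : ℤ) - m)) (B.trans e), fun i j hij ↦ ?_,
      fun i ↦ ?_⟩
    · have := hinj (quotient_trans_right_injective _ hij)
      ext
      omega
    · rcases le_or_gt (m : ℤ) i with hi | hi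
      · refine ((haL.zpow ((i : ℤ) - m)).trans (hB.trans he)).mono ?_
        have h4 : (2 * ((i : ℤ) - m).natAbs + 2 : ℕ) ≤ 2 * m := by omega
        have h5 : ((2 * ((i : ℤ) - m).natAbs + 2 : ℕ) : ℝ≥0) ≤ (2 * m : ℕ) := by exact_mod_cast h4
        calc _ = ((2 * ((i : ℤ) - m).natAbs + 2 : ℕ) : ℝ≥0) * D := by push_cast; ring
          _ ≤ _ := by gcongr
      -- For a negative exponent, going back along `C` in place of `B` saves one full turn of the
      -- loop, since B = a C⁻¹.
      · have h6 : Path.Homotopic.Quotient.trans (x₁ := x)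
            (a ^ ((i : ℤ) - m)) (B.trans e) =
            Path.Homotopic.Quotient.trans (x₁ := x)
            (a ^ ((i : ℤ) - m + 1)) (C.symm.trans e) := by
          rw [add_comm _ (1 : ℤ), zpow_one_add, FundamentalGroup.mul_def,
            Path.Homotopic.Quotient.trans_assoc]
          congr 1
          rw [← Path.Homotopic.Quotient.trans_assoc]
          congr 1
          calc B = (B.trans C).trans C.symm := by simp [Path.Homotopic.Quotient.trans_assoc]
            _ = _ := by rw [hBC]
        change LengthLE (Path.Homotopic.Quotient.trans (x₁ := x)
            (a ^ ((i : ℤ) - m)) (B.trans e)) _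
        rw [h6]
        refine ((haL.zpow ((i : ℤ) - m + 1)).trans (hC.symm.trans he)).mono ?_
        have h4 : (2 * ((i : ℤ) - m + 1).natAbs + 2 : ℕ) ≤ 2 * m := by omega
        have h5 : ((2 * ((i : ℤ) - m + 1).natAbs + 2 : ℕ) : ℝ≥0) ≤ (2 * m : ℕ) := by
          exact_mod_cast h4
        calc _ = ((2 * ((i : ℤ) - m + 1).natAbs + 2 : ℕ) : ℝ≥0) * D := by push_cast; ring
          _ ≤ _ := by gcongr
  · obtain ⟨e, he⟩ := hL.exists_lengthLE hr hS x y
    replace he := he.mono (hD x y)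
    -- Odd case: the exponents run symmetrically from -m to m.
    refine ⟨fun i ↦ Path.Homotopic.Quotient.trans (x₁ := x)
      (a ^ ((i : ℤ) - m)) e, fun i j hij ↦ ?_,
      fun i ↦ ?_⟩
    · have := hinj (quotient_trans_right_injective _ hij)
      ext
      omega
    · refine ((haL.zpow ((i : ℤ) - m)).trans he).mono ?_
      have h4 : (2 * ((i : ℤ) - m).natAbs + 1 : ℕ) ≤ 2 * m + 1 := by omega
      have h5 : ((2 * ((i : ℤ) - m).natAbs + 1 : ℕ) : ℝ≥0) ≤ (2 * m + 1 : ℕ) := by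
        exact_mod_cast h4
      calc _ = ((2 * ((i : ℤ) - m).natAbs + 1 : ℕ) : ℝ≥0) * D := by push_cast; ring
        _ ≤ _ := by gcongr

/-- In a compact space whose fundamental group is non-trivial and torsion-free, any two points are
joined by `k` pairwise non-homotopic paths whose Lipschitz constants are minimal in their homotopy
classes and at most `k` times the diameter. -/
lemma exists_minimal_lipschitzWith [CompactSpace X] {r : ℝ} (hr : 0 < r)
    (hS : SmallPathsHomotopic X r) (hL : HasShortPaths X) {D : ℝ≥0}
    (hD : ∀ x y : X, nndist x y ≤ D) (x y : X) [Nontrivial (FundamentalGroup X x)]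
    (htf : ∀ g : FundamentalGroup X x, g ≠ 1 → ¬ IsOfFinOrder g) (k : ℕ) :
    ∃ (γ : Fin k → Path x y) (ℓ : Fin k → ℝ≥0), (∀ i j, i ≠ j → ¬ (γ i).Homotopic (γ j)) ∧
      (∀ i, ℓ i ≤ k * D) ∧ (∀ i, LipschitzWith (ℓ i) (γ i)) ∧
      ∀ i L, LengthLE (.mk (γ i)) L → ℓ i ≤ L := by
  obtain ⟨A, hA, hAL⟩ := exists_injective_lengthLE hr hS hL hD x y htf k
  let s : Fin k → Set ℝ≥0 := fun i ↦ {L | LengthLE (A i) L}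
  have hs : ∀ i, (s i).Nonempty := fun i ↦ ⟨_, hAL i⟩
  -- The slack `δ` built into `LengthLE` makes the set of admissible lengths closed under its
  -- infimum.
  have hmin : ∀ i, LengthLE (A i) (sInf (s i)) := fun i δ hδ ↦ by
    obtain ⟨L, hL, hL'⟩ := exists_lt_of_csInf_lt (hs i)
      (show sInf (s i) < sInf (s i) + δ / 2 from lt_add_of_pos_right _ (by positivity))
    obtain ⟨γ, h1, h2⟩ := hL (δ / 2) (by positivity)
    refine ⟨γ, h1, h2.weaken ?_⟩
    calc L + δ / 2 ≤ sInf (s i) + δ / 2 + δ / 2 := by gcongr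
      _ = _ := by rw [add_assoc, add_halves]
  choose γ hγ hγL using fun i ↦ (hmin i).exists_lipschitzWith hr hS hL
  refine ⟨γ, fun i ↦ sInf (s i), fun i j hij h ↦ hij (hA ?_), fun i ↦ ?_, hγL, fun i L h ↦ ?_⟩
  · rw [← hγ, ← hγ]
    exact Path.Homotopic.Quotient.eq.2 h
  · exact csInf_le (OrderBot.bddBelow _) (hAL i)
  · rw [hγ] at h
    exact csInf_le (OrderBot.bddBelow _) h

end FundamentalGroup

end RiemannianGeodesic

namespace RiemannianGeodesic

open Set Filter Topology MeasureTheory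
open scoped NNReal ENNReal

/-! ### From integral bounds on increments to Lipschitz representatives -/

section LengthControl

open scoped unitInterval

variable {X : Type*} [MetricSpace X] {x y : X}

/-- Increments are integrals over intervals shrinking to a null point, so absolute continuity of the
integral applies; no measurability of `f` is needed. It makes the arc length function of a curve a
legitimate clock for `exists_homotopic_lipschitzWith`. -/
lemma continuous_toReal_setLIntegral_Iic {μ : Measure ℝ} [NullSingletonClass μ] [IsFiniteMeasure μ]
    {f : ℝ → ℝ≥0∞} (hf : ∫⁻ t, f t ∂μ ≠ ⊤) :
    Continuous fun t ↦ (∫⁻ u in Iic t, f u ∂μ).toReal := by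
  have hfin : ∀ s : Set ℝ, ∫⁻ u in s, f u ∂μ ≠ ⊤ := fun s ↦
    ne_top_of_le_ne_top hf (setLIntegral_le_lintegral _ _)
  have hadd : ∀ s t : ℝ, s ≤ t → (∫⁻ u in Iic t, f u ∂μ).toReal =
      (∫⁻ u in Iic s, f u ∂μ).toReal + (∫⁻ u in Ioc s t, f u ∂μ).toReal := fun s t hst ↦ by
    rw [← Iic_union_Ioc_eq_Iic hst, lintegral_union measurableSet_Ioc
      (Iic_disjoint_Ioc le_rfl), ENNReal.toReal_add (hfin _) (hfin _)]
  refine continuous_iff_continuousAt.2 fun t₀ ↦ ?_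
  have hdist : ∀ t, dist (∫⁻ u in Iic t, f u ∂μ).toReal (∫⁻ u in Iic t₀, f u ∂μ).toReal =
      (∫⁻ u in uIoc t₀ t, f u ∂μ).toReal := fun t ↦ by
    rcases le_total t t₀ with h | h
    · rw [uIoc_of_ge h, hadd _ _ h, dist_self_add_right, Real.norm_of_nonneg ENNReal.toReal_nonneg]
    · rw [uIoc_of_le h, hadd _ _ h, dist_self_add_left, Real.norm_of_nonneg ENNReal.toReal_nonneg]
  have hμ : Tendsto (μ ∘ fun t ↦ uIoc t₀ t) (𝓝 t₀) (𝓝 0) := by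
    have h1 : Tendsto (fun t ↦ μ (Metric.closedBall t₀ (dist t t₀))) (𝓝 t₀) (𝓝 0) := by
      have h2 := tendsto_measure_cthickening_of_isClosed (μ := μ) (s := {t₀})
        ⟨1, one_pos, measure_ne_top _ _⟩ isClosed_singleton
      rw [measure_singleton] at h2
      have h3 : Tendsto (fun t ↦ dist t t₀) (𝓝 t₀) (𝓝 0) := by
        simpa using (continuous_id.dist (continuous_const (y := t₀))).tendsto t₀
      refine (h2.comp h3).congr fun t ↦ ?_
      simp [Metric.cthickening_singleton]
    refine tendsto_of_tendsto_of_tendsto_of_le_of_le tendsto_const_nhds h1 (fun _ ↦ zero_le)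
      fun t ↦ measure_mono fun u hu ↦ ?_
    have := uIoc_subset_uIcc hu
    rw [Metric.mem_closedBall, Real.dist_eq, Real.dist_eq]
    have h4 := abs_sub_left_of_mem_uIcc this
    exact h4
  rw [ContinuousAt, tendsto_iff_dist_tendsto_zero]
  simp only [hdist]
  have := tendsto_setLIntegral_zero hf hμ
  exact (ENNReal.tendsto_toReal ENNReal.zero_ne_top).comp this

/-- A curve whose increments are dominated by the integrals of a function `f` has length at most
the integral of `f`. -/
lemma LengthLE.of_lintegral {f : ℝ → ℝ≥0∞} {a b : ℝ} (hab : a ≤ b) {L : ℝ≥0}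
    (hL : ∫⁻ t in Icc a b, f t ≤ L) {P : Path x y} {c : ℝ → X}
    (hP : ∀ τ : I, P τ = c (a + (b - a) * τ))
    (h : ∀ s t, a ≤ s → s ≤ t → t ≤ b → edist (c s) (c t) ≤ ∫⁻ u in Icc s t, f u) :
    LengthLE (.mk P) L := by
  intro δ hδ
  set μ := (volume : Measure ℝ).restrict (Icc a b) with hμ
  have hfin : ∫⁻ t, f t ∂μ ≠ ⊤ := ne_top_of_le_ne_top ENNReal.coe_ne_top hL
  have hcont := continuous_toReal_setLIntegral_Iic hfin
  set F : ℝ → ℝ := fun t ↦ (∫⁻ u in Iic t, f u ∂μ).toReal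
  obtain ⟨γ, hγ, hγL⟩ := exists_homotopic_lipschitzWith P (fun τ : I ↦ F (a + (b - a) * τ))
    (by fun_prop) (L := L) (δ := δ) (fun s t hst ↦ by
      rw [hP, hP]
      have hst' : (s : ℝ) ≤ t := hst
      have hba : 0 ≤ b - a := sub_nonneg.2 hab
      set s' := a + (b - a) * (s : ℝ)
      set t' := a + (b - a) * (t : ℝ)
      have h1 : a ≤ s' := le_add_of_nonneg_right (mul_nonneg hba s.2.1)
      have h2 : s' ≤ t' := by simp only [s', t']; gcongr
      have h3 : t' ≤ b := by
        have := mul_le_mul_of_nonneg_left t.2.2 hba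
        simp only [t']
        linarith
      have hfin' : ∀ s : Set ℝ, ∫⁻ u in s, f u ∂μ ≠ ⊤ := fun s ↦
        ne_top_of_le_ne_top hfin (setLIntegral_le_lintegral _ _)
      have hadd : F t' = F s' + (∫⁻ u in Ioc s' t', f u ∂μ).toReal := by
        simp only [F]
        rw [← Iic_union_Ioc_eq_Iic h2, lintegral_union measurableSet_Ioc
          (Iic_disjoint_Ioc le_rfl),
          ENNReal.toReal_add (hfin' _) (hfin' _)]
      rw [hadd, add_sub_cancel_left, dist_edist]
      refine ENNReal.toReal_mono (hfin' _) ((h _ _ h1 h2 h3).trans (le_of_eq ?_))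
      rw [hμ, Measure.restrict_restrict measurableSet_Ioc,
        inter_eq_self_of_subset_left (Ioc_subset_Icc_self.trans (Icc_subset_Icc h1 h3))]
      exact setLIntegral_congr Ioc_ae_eq_Icc.symm)
    (by
      have h0 : 0 ≤ F (a + (b - a) * (0 : I)) := ENNReal.toReal_nonneg
      have h1 : F (a + (b - a) * (1 : I)) ≤ L := by
        refine ENNReal.toReal_le_coe_of_le_coe ((setLIntegral_le_lintegral _ _).trans hL)
      linarith) hδ
  exact ⟨γ, Path.Homotopic.Quotient.eq.2 hγ, hγL⟩

end LengthControl

/-! ### Riemannian manifolds satisfy the metric hypotheses -/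

section Riemannian

variable {n : ℕ} {M : Type*} [MetricSpace M]
    [ChartedSpace (EuclideanSpace ℝ (Fin n)) M]

/-- Two paths with the same endpoints inside the preimage of a ball under a chart
are homotopic. -/
lemma homotopic_of_mem_chart {p : M} {R : ℝ}
    (hR : Metric.ball (extChartAt (𝓡 n) p p) R ⊆ (extChartAt (𝓡 n) p).target)
    {x y : M} {γ η : Path x y}
    (hγ : ∀ t, γ t ∈ (extChartAt (𝓡 n) p).source ∩
      extChartAt (𝓡 n) p ⁻¹' Metric.ball (extChartAt (𝓡 n) p p) R)
    (hη : ∀ t, η t ∈ (extChartAt (𝓡 n) p).source ∩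
      extChartAt (𝓡 n) p ⁻¹' Metric.ball (extChartAt (𝓡 n) p p) R) : γ.Homotopic η := by
  set φ := extChartAt (𝓡 n) p
  set B := Metric.ball (φ p) R
  have hx : x ∈ φ.source ∩ φ ⁻¹' B := γ.source ▸ hγ 0
  have hy : y ∈ φ.source ∩ φ ⁻¹' B := γ.target ▸ hγ 1
  have hne : B.Nonempty := ⟨_, hx.2⟩
  -- The chart ball is convex, so the coordinate images of the two paths are homotopic in it; the
  -- inverse chart carries the homotopy back.
  have : ContractibleSpace B := (convex_ball _ _).contractibleSpace hne
  let Φ : C(B, M) := ⟨fun z ↦ φ.symm z,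
    ((continuousOn_extChartAt_symm p).mono hR).domRestrict⟩
  have lift : ∀ ζ : Path x y, (∀ t, ζ t ∈ φ.source ∩ φ ⁻¹' B) →
      ∃ ζ' : Path (⟨φ x, hx.2⟩ : B) ⟨φ y, hy.2⟩, ∀ t, Φ (ζ' t) = ζ t := fun ζ hζ ↦ by
    refine ⟨⟨⟨fun t ↦ ⟨φ (ζ t), (hζ t).2⟩, ?_⟩, ?_, ?_⟩, fun t ↦ ?_⟩
    · refine Continuous.subtype_mk ?_ _
      exact (continuousOn_extChartAt p).comp_continuous ζ.continuous fun t ↦ (hζ t).1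
    · simp
    · simp
    · exact φ.left_inv (hζ t).1
  obtain ⟨γ', hγ'⟩ := lift γ hγ
  obtain ⟨η', hη'⟩ := lift η hη
  have h1 : x = Φ ⟨φ x, hx.2⟩ := (φ.left_inv hx.1).symm
  have h2 : y = Φ ⟨φ y, hy.2⟩ := (φ.left_inv hy.1).symm
  have := ((SimplyConnectedSpace.paths_homotopic γ' η').map Φ).pathCast h1 h2
  convert this using 1
  · ext t
    exact (hγ' t).symm
  · ext t
    exact (hη' t).symm

lemma exists_ball_subset_target (p : M) :
    ∃ R > 0, Metric.ball (extChartAt (𝓡 n) p p) R ⊆ (extChartAt (𝓡 n) p).target :=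
  Metric.isOpen_iff.1 (isOpen_extChartAt_target p) _ (mem_extChartAt_target p)

lemma chart_preimage_ball_mem_nhds (p : M) {R : ℝ} (hR : 0 < R) :
    (extChartAt (𝓡 n) p).source ∩
      extChartAt (𝓡 n) p ⁻¹' Metric.ball (extChartAt (𝓡 n) p p) R ∈ 𝓝 p :=
  inter_mem (extChartAt_source_mem_nhds p)
    ((continuousAt_extChartAt p).preimage_mem_nhds (Metric.ball_mem_nhds _ hR))

/-- `r` is a Lebesgue number of the cover by interiors of chart balls. -/
lemma exists_smallPathsHomotopic (n : ℕ) (M : Type*) [MetricSpace M]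
    [ChartedSpace (EuclideanSpace ℝ (Fin n)) M] [CompactSpace M] :
    ∃ r > 0, SmallPathsHomotopic M r := by
  choose R hR hRt using fun p : M ↦ exists_ball_subset_target (n := n) p
  obtain ⟨δ, hδ, h⟩ := lebesgue_number_lemma_of_metric (s := (univ : Set M)) isCompact_univ
    (fun p ↦ isOpen_interior (s := (extChartAt (𝓡 n) p).source ∩
      extChartAt (𝓡 n) p ⁻¹' Metric.ball (extChartAt (𝓡 n) p p) (R p)))
    (fun p _ ↦ mem_iUnion.2 ⟨p, mem_interior_iff_mem_nhds.2
      (chart_preimage_ball_mem_nhds p (hR p))⟩)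
  refine ⟨δ, hδ, fun q x y γ η hγ hη ↦ ?_⟩
  obtain ⟨p, hp⟩ := h q (mem_univ q)
  exact homotopic_of_mem_chart (hRt p) (fun t ↦ interior_subset (hp (hγ t)))
    fun t ↦ interior_subset (hp (hη t))

variable [RiemannianBundle (fun q : M ↦ TangentSpace (𝓡 n) q)]
    [IsRiemannianManifold (𝓡 n) M]

lemma edist_le_pathELength {c : ℝ → M} {a b : ℝ} (hab : a ≤ b)
    (hc : ContMDiffOn 𝓘(ℝ, ℝ) (𝓡 n) 1 c (Icc a b)) :
    edist (c a) (c b) ≤ Manifold.pathELength (𝓡 n) c a b := by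
  rw [IsRiemannianManifold.out (I := 𝓡 n)]
  exact Manifold.riemannianEDist_le_pathELength hc rfl rfl hab

/-- The bound is needed between arbitrary times, not only subdivision points, because
`LengthLE.of_lintegral` asks for it on every subinterval. The induction splits the interval at the
last subdivision point it contains. -/
lemma edist_le_pathELength_of_piecewise {c : ℝ → M} {m : ℕ} {t : Fin (m + 1) → ℝ}
    (hc : ∀ i : Fin m,
      ContMDiffOn 𝓘(ℝ, ℝ) (𝓡 n) 1 c (Icc (t i.castSucc) (t i.succ)))
    {a b : ℝ} (ha : t 0 ≤ a) (hab : a ≤ b) (hb : b ≤ t (Fin.last m)) :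
    edist (c a) (c b) ≤ Manifold.pathELength (𝓡 n) c a b := by
  have key : ∀ i : Fin (m + 1), ∀ a b, t 0 ≤ a → a ≤ b → b ≤ t i →
      edist (c a) (c b) ≤ Manifold.pathELength (𝓡 n) c a b := by
    intro i
    induction i using Fin.induction with
    | zero =>
      intro a b ha hab hb
      obtain rfl : a = b := le_antisymm hab (hb.trans ha)
      simp
    | succ i ih =>
      intro a b ha hab hb
      rcases le_total b (t i.castSucc) with h | h
      · exact ih a b ha hab h
      · rcases le_total (t i.castSucc) a with h' | h'
        · exact edist_le_pathELength hab ((hc i).mono (Icc_subset_Icc h' hb))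
        · rw [← Manifold.pathELength_add h' h]
          exact (edist_triangle _ (c (t i.castSucc)) _).trans (add_le_add (ih _ _ ha h' le_rfl)
            (edist_le_pathELength h ((hc i).mono (Icc_subset_Icc le_rfl hb))))
  exact key (Fin.last m) a b ha hab hb

lemma LengthLE.of_isPiecewiseC1 {x y : M} {c : Path x y} (hc : IsPiecewiseC1 (n := n) c)
    {L : ℝ≥0} (hL : length (n := n) c ≤ L) : LengthLE (.mk c) L := by
  obtain ⟨m, t, -, h0, h1, hct⟩ := hc
  refine LengthLE.of_lintegral (f := fun s ↦ ‖mfderiv 𝓘(ℝ, ℝ) (𝓡 n) c.extend s 1‖ₑ)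
    (c := c.extend) zero_le_one ?_ (fun τ ↦ ?_) fun s u hs hsu hu ↦ ?_
  · rwa [length, Manifold.pathELength_eq_lintegral_mfderiv_Icc] at hL
  · simp
  · rw [← Manifold.pathELength_eq_lintegral_mfderiv_Icc]
    exact edist_le_pathELength_of_piecewise hct (h0 ▸ hs) hsu (h1 ▸ hu)

/-- The distance is the infimum of lengths of C¹ paths; an almost optimal one is reparametrized.
Half of `δ` pays for near optimality, half for the reparametrization. -/
lemma hasShortPaths (n : ℕ) (M : Type*) [MetricSpace M]
    [ChartedSpace (EuclideanSpace ℝ (Fin n)) M]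
    [RiemannianBundle (fun q : M ↦ TangentSpace (𝓡 n) q)] [IsRiemannianManifold (𝓡 n) M] :
    HasShortPaths M := by
  intro x y δ hδ
  obtain ⟨c, h0, h1, hc, hcL⟩ := Manifold.exists_lt_of_riemannianEDist_lt (I := 𝓡 n) (x := x)
    (y := y) (r := ((nndist x y + δ / 2 : ℝ≥0) : ℝ≥0∞)) (by
      rw [← IsRiemannianManifold.out (I := 𝓡 n), edist_nndist, ENNReal.coe_lt_coe]
      exact lt_add_of_pos_right _ (by positivity))
  let P : Path x y := ⟨⟨fun t ↦ c t, hc.continuousOn.domRestrict⟩, by simpa using h0,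
    by simpa using h1⟩
  obtain ⟨γ, -, hγ⟩ := LengthLE.of_lintegral (P := P) (c := c)
    (f := fun s ↦ ‖mfderiv 𝓘(ℝ, ℝ) (𝓡 n) c s 1‖ₑ) zero_le_one
    (by rw [← Manifold.pathELength_eq_lintegral_mfderiv_Icc]; exact hcL.le)
    (fun τ ↦ by simp only [sub_zero, one_mul, zero_add]; rfl) (fun s u hs hsu hu ↦ by
      rw [← Manifold.pathELength_eq_lintegral_mfderiv_Icc]
      exact edist_le_pathELength hsu (hc.mono (Icc_subset_Icc hs hu))) (δ / 2) (by positivity)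
  exact ⟨γ, by rwa [add_assoc, add_halves] at hγ⟩

end Riemannian

end RiemannianGeodesic

noncomputable section

namespace RiemannianGeodesic

open Set Filter Topology MeasureTheory
open scoped NNReal ENNReal

/-! ### The metric in a chart: positivity and smoothness -/

section ChartMetric

variable {n : ℕ} {M : Type*} [TopologicalSpace M]
    [ChartedSpace (EuclideanSpace ℝ (Fin n)) M]
    [RiemannianBundle (fun q : M ↦ TangentSpace (𝓡 n) q)]

/-- The Riemannian metric in a chart, as a continuous bilinear form. -/
def chartForm (p : M) (z : EuclideanSpace ℝ (Fin n)) :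
    EuclideanSpace ℝ (Fin n) →L[ℝ] EuclideanSpace ℝ (Fin n) →L[ℝ] ℝ :=
  (LinearMap.mk₂ ℝ (chartMetric p z)
    (fun v v' w ↦ by
      simp only [chartMetric]
      rw [← inner_add_left]
      exact congrArg (fun a ↦ inner ℝ a _) (map_add _ v v'))
    (fun c v w ↦ by
      simp only [chartMetric]
      rw [smul_eq_mul, ← real_inner_smul_left]
      exact congrArg (fun a ↦ inner ℝ a _) (map_smul _ c v))
    (fun v w w' ↦ by
      simp only [chartMetric]
      rw [← inner_add_right]
      exact congrArg (fun a ↦ inner ℝ _ a) (map_add _ w w'))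
    (fun c v w ↦ by
      simp only [chartMetric]
      rw [smul_eq_mul, ← real_inner_smul_right]
      exact congrArg (fun a ↦ inner ℝ _ a) (map_smul _ c w))).toContinuousBilinearMap

lemma chartForm_apply (p : M) (z v w : EuclideanSpace ℝ (Fin n)) :
    chartForm p z v w = chartMetric p z v w := rfl

lemma chartForm_symm (p : M) (z v w : EuclideanSpace ℝ (Fin n)) :
    chartForm p z v w = chartForm p z w v := by
  rw [chartForm_apply, chartForm_apply, chartMetric, chartMetric]
  exact real_inner_comm _ _

lemma sqrt_chartForm_self (p : M) (z v : EuclideanSpace ℝ (Fin n)) :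
    √(chartForm p z v v) = ‖mfderiv (𝓡 n) (𝓡 n) (extChartAt (𝓡 n) p).symm z v‖ := by
  rw [chartForm_apply, chartMetric, real_inner_self_eq_norm_sq, Real.sqrt_sq (norm_nonneg _)]

variable [IsManifold (𝓡 n) ∞ M]

/-- The derivative of the inverse chart is invertible, so a non-zero coordinate vector represents a
non-zero tangent vector. -/
lemma chartForm_self_pos {p : M} {z : EuclideanSpace ℝ (Fin n)}
    (hz : z ∈ (extChartAt (𝓡 n) p).target) {v : EuclideanSpace ℝ (Fin n)} (hv : v ≠ 0) :
    0 < chartForm p z v v := by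
  rw [chartForm_apply, chartMetric]
  refine real_inner_self_pos.2 fun h ↦ hv ?_
  have h1 := isInvertible_mfderivWithin_extChartAt_symm (I := 𝓡 n) hz
  rw [ModelWithCorners.range_eq_univ, mfderivWithin_univ] at h1
  exact h1.injective (h.trans (map_zero _).symm)

variable [IsContMDiffRiemannianBundle (𝓡 n) ∞ (EuclideanSpace ℝ (Fin n))
      (fun q : M ↦ TangentSpace (𝓡 n) q)]

/-- The tangent map of the inverse chart turns constant coordinate fields into smooth fields along
it, and the inner product of smooth fields is smooth. -/
lemma contDiffOn_chartMetric (p : M) (v w : EuclideanSpace ℝ (Fin n)) :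
    ContDiffOn ℝ ∞ (fun z ↦ chartMetric p z v w) (extChartAt (𝓡 n) p).target := by
  have hopen := isOpen_extChartAt_target (I := 𝓡 n) p
  have h1 : ContMDiffOn (𝓡 n) (𝓡 n) ∞ (extChartAt (𝓡 n) p).symm (extChartAt (𝓡 n) p).target :=
    contMDiffOn_extChartAt_symm p
  have h2 := h1.contMDiffOn_tangentMapWithin (m := ∞) (by simp) hopen.uniqueMDiffOn
  have h3 : ∀ v : EuclideanSpace ℝ (Fin n), ContMDiffOn (𝓡 n) (𝓡 n).tangent ∞
      (fun z ↦ (⟨(extChartAt (𝓡 n) p).symm z,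
        mfderiv (𝓡 n) (𝓡 n) (extChartAt (𝓡 n) p).symm z v⟩ : TangentBundle (𝓡 n) M))
      (extChartAt (𝓡 n) p).target := fun v ↦ by
    have h4 : ContMDiffOn (𝓡 n) (𝓡 n).tangent ∞ (fun z ↦
        (⟨z, v⟩ : TangentBundle (𝓡 n) (EuclideanSpace ℝ (Fin n)))) (extChartAt (𝓡 n) p).target :=
      contMDiffOn_vectorSpace_iff_contDiffOn.2 contDiffOn_const
    refine (h2.comp h4 fun z hz ↦ hz).congr fun z hz ↦ ?_
    simp only [Function.comp_apply, tangentMapWithin]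
    rw [mfderivWithin_of_isOpen hopen hz]
  rw [← contMDiffOn_iff_contDiffOn]
  exact ContMDiffOn.inner_bundle (h3 v) (h3 w)

lemma contDiffOn_chartForm (p : M) :
    ContDiffOn ℝ ∞ (chartForm (n := n) p) (extChartAt (𝓡 n) p).target := by
  refine contDiffOn_clm_apply.2 fun v ↦ contDiffOn_clm_apply.2 fun w ↦ ?_
  exact contDiffOn_chartMetric p v w

end ChartMetric

end RiemannianGeodesic

end

noncomputable section

namespace RiemannianGeodesic

open Set Filter Topology MeasureTheory
open scoped NNReal ENNReal

/-! ### Integrals of bounded functions and the lemma of du Bois-Reymond -/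

section Calculus

variable {F : Type*} [NormedAddCommGroup F]

lemma intervalIntegrable_of_norm_le {f : ℝ → F} {a b C : ℝ} (hf : AEStronglyMeasurable f)
    (hC : ∀ t ∈ uIoc a b, ‖f t‖ ≤ C) : IntervalIntegrable f volume a b := by
  rw [intervalIntegrable_iff]
  refine Measure.integrableOn_of_bounded (M := C) (by simp) hf ?_
  exact (ae_restrict_iff' measurableSet_uIoc).2 (ae_of_all _ hC)

lemma lipschitzWith_integral_of_norm_le [NormedSpace ℝ F] {f : ℝ → F} {C : ℝ≥0} (a : ℝ)
    (hf : AEStronglyMeasurable f) (hC : ∀ t, ‖f t‖ ≤ C) :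
    LipschitzWith C fun t ↦ ∫ s in a..t, f s := by
  have hint : ∀ s t, IntervalIntegrable f volume s t := fun s t ↦
    intervalIntegrable_of_norm_le hf fun t _ ↦ hC t
  refine LipschitzWith.of_dist_le_mul fun s t ↦ ?_
  rw [dist_eq_norm, intervalIntegral.integral_interval_sub_left (hint _ _) (hint _ _),
    Real.dist_eq]
  exact intervalIntegral.norm_integral_le_of_norm_le_const fun u _ ↦ hC u

lemma ae_hasDerivAt_integral_of_norm_le [NormedSpace ℝ F] [CompleteSpace F] {f : ℝ → F} {C : ℝ}
    (hf : AEStronglyMeasurable f) (hC : ∀ t, ‖f t‖ ≤ C) (a : ℝ) :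
    ∀ᵐ t, HasDerivAt (fun t ↦ ∫ s in a..t, f s) (f t) t := by
  have : LocallyIntegrable f volume := by
    rw [locallyIntegrable_iff]
    intro K hK
    exact Measure.integrableOn_of_bounded (M := C) hK.measure_lt_top.ne hf (ae_of_all _ hC)
  filter_upwards [LocallyIntegrable.ae_hasDerivAt_integral this] with t ht using ht a

/-- The lemma of du Bois-Reymond. -/
lemma ae_eq_const_add_integral_of_forall_lipschitz {a b : ℝ} (hab : a < b) {A B : ℝ → ℝ}
    (hA : AEStronglyMeasurable A) (hB : AEStronglyMeasurable B) {C : ℝ≥0}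
    (hAC : ∀ t, ‖A t‖ ≤ C) (hBC : ∀ t, ‖B t‖ ≤ C)
    (h : ∀ (η : ℝ → ℝ) (K : ℝ≥0), LipschitzWith K η → (∀ t ∉ Ioo a b, η t = 0) →
      ∫ t in a..b, (A t * η t + B t * deriv η t) = 0) :
    ∃ c, ∀ᵐ t, t ∈ Ioc a b → B t = c + ∫ s in a..t, A s := by
  have hPL := lipschitzWith_integral_of_norm_le a hA hAC
  have hPd := ae_hasDerivAt_integral_of_norm_le hA hAC a
  set P : ℝ → ℝ := fun t ↦ ∫ s in a..t, A s with hP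
  set D : ℝ → ℝ := fun t ↦ B t - P t with hD
  -- The mean value of `D`: this makes the primitive `η` of D - c vanish at `b` as well as at `a`,
  -- so it is an admissible test function.
  set c : ℝ := (b - a)⁻¹ * ∫ t in a..b, D t with hc
  have hPle : ∀ t ∈ Ioc a b, ‖P t‖ ≤ C * (b - a) := fun t ht ↦ by
    have := hPL.dist_le_mul t a
    simp only [hP, intervalIntegral.integral_same, dist_zero_right] at this
    refine this.trans ?_
    rw [Real.dist_eq, abs_of_nonneg (by linarith [ht.1])]
    gcongr
    exact ht.2
  have hDm : AEStronglyMeasurable D := hB.sub hPL.continuous.aestronglyMeasurable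
  have hDle : ∀ t ∈ Ioc a b, ‖D t‖ ≤ C + C * (b - a) := fun t ht ↦
    (norm_sub_le _ _).trans (add_le_add (hBC t) (hPle t ht))
  have hDint : IntervalIntegrable D volume a b :=
    intervalIntegrable_of_norm_le hDm (by rwa [uIoc_of_le hab.le])
  set k : ℝ → ℝ := (Ioc a b).indicator fun t ↦ D t - c with hk
  have hkm : AEStronglyMeasurable k := (hDm.sub aestronglyMeasurable_const).indicator
    measurableSet_Ioc
  obtain ⟨C', hC'⟩ : ∃ C' : ℝ≥0, ∀ t, ‖k t‖ ≤ C' := by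
    have h0 : 0 ≤ C * (b - a) := mul_nonneg C.2 (by linarith)
    refine ⟨⟨C + C * (b - a) + ‖c‖, by positivity⟩, fun t ↦ ?_⟩
    change ‖k t‖ ≤ C + C * (b - a) + ‖c‖
    by_cases ht : t ∈ Ioc a b
    · rw [hk, indicator_of_mem ht]
      exact (norm_sub_le _ _).trans (add_le_add (hDle t ht) le_rfl)
    · rw [hk, indicator_of_notMem ht, norm_zero]
      positivity
  have hkint : ∀ s t, IntervalIntegrable k volume s t := fun s t ↦
    intervalIntegrable_of_norm_le hkm fun t _ ↦ hC' t
  have hηL := lipschitzWith_integral_of_norm_le a hkm hC'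
  have hηd := ae_hasDerivAt_integral_of_norm_le hkm hC' a
  set η : ℝ → ℝ := fun t ↦ ∫ s in a..t, k s with hη
  have hηa : η a = 0 := by simp [hη]
  have hηb : η b = 0 := by
    have : ∫ s in a..b, k s = ∫ s in a..b, (D s - c) := by
      refine intervalIntegral.integral_congr_ae (ae_of_all _ fun t ht ↦ ?_)
      rw [uIoc_of_le hab.le] at ht
      rw [hk, indicator_of_mem ht]
    simp only [hη]
    rw [this, intervalIntegral.integral_sub hDint intervalIntegrable_const,
      intervalIntegral.integral_const, hc, smul_eq_mul, mul_inv_cancel_left₀ (by linarith),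
      sub_self]
  have hη0 : ∀ t ∉ Ioo a b, η t = 0 := by
    intro t ht
    rcases le_or_gt t a with hta | hta
    · simp only [hη]
      refine intervalIntegral.integral_zero_ae (ae_of_all _ fun s hs ↦ ?_)
      rw [uIoc_of_ge hta] at hs
      exact indicator_of_notMem (fun hs' ↦ by linarith [hs.2, hs'.1]) _
    · have htb : b ≤ t := not_lt.1 fun h ↦ ht ⟨hta, h⟩
      have : ∫ s in b..t, k s = 0 := by
        refine intervalIntegral.integral_zero_ae (ae_of_all _ fun s hs ↦ ?_)
        rw [uIoc_of_le htb] at hs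
        exact indicator_of_notMem (fun hs' ↦ by linarith [hs.1, hs'.2]) _
      simp only [hη] at hηb ⊢
      rw [← intervalIntegral.integral_add_adjacent_intervals (hkint a b) (hkint b t), hηb, this,
        add_zero]
  have h1 := h η C' hηL hη0
  have hPac := (hPL.lipschitzOnWith (s := uIcc a b)).absolutelyContinuousOnInterval
  have hηac := (hηL.lipschitzOnWith (s := uIcc a b)).absolutelyContinuousOnInterval
  -- Integration by parts replaces A η by -P k. The tested identity then says that (B - P) k
  -- integrates to 0, and since k itself has integral 0, so does k².
  have h2 := hPac.integral_deriv_mul_eq_sub hηac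
  rw [hηa, hηb, mul_zero, mul_zero, sub_zero] at h2
  have h3 : ∫ t in a..b, k t * k t = 0 := by
    have hi1 : IntervalIntegrable (fun t ↦ A t * η t + B t * k t) volume a b :=
      ((intervalIntegrable_of_norm_le hA fun t _ ↦ hAC t).mul_continuousOn
        hηL.continuous.continuousOn).add
        (intervalIntegrable_of_norm_le (hB.mul hkm) (C := C * C') fun t _ ↦ by
          rw [norm_mul]
          exact mul_le_mul (hBC t) (hC' t) (norm_nonneg _) C.2)
    have hi2 : IntervalIntegrable (fun t ↦ A t * η t + P t * k t) volume a b :=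
      ((intervalIntegrable_of_norm_le hA fun t _ ↦ hAC t).mul_continuousOn
        hηL.continuous.continuousOn).add
        ((hkint a b).continuousOn_mul hPL.continuous.continuousOn)
    have e1 : ∫ t in a..b, (A t * η t + B t * k t) = 0 := by
      rw [← h1]
      refine intervalIntegral.integral_congr_ae ?_
      filter_upwards [hηd] with t ht _
      rw [ht.deriv]
    have e2 : ∫ t in a..b, (A t * η t + P t * k t) = 0 := by
      rw [← h2]
      refine intervalIntegral.integral_congr_ae ?_
      filter_upwards [hηd, hPd] with t ht ht' _
      rw [ht.deriv, ht'.deriv]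
    have e3 : ∫ t in a..b, c * k t = 0 := by
      rw [intervalIntegral.integral_const_mul]
      simp only [hη] at hηb
      rw [hηb, mul_zero]
    have e4 : ∫ t in a..b, k t * k t = (∫ t in a..b, (A t * η t + B t * k t)) -
        (∫ t in a..b, (A t * η t + P t * k t)) - ∫ t in a..b, c * k t := by
      rw [← intervalIntegral.integral_sub hi1 hi2,
        ← intervalIntegral.integral_sub (hi1.sub hi2) ((hkint a b).const_mul c)]
      refine intervalIntegral.integral_congr_ae (ae_of_all _ fun t ht ↦ ?_)
      rw [uIoc_of_le hab.le] at ht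
      have : k t = B t - P t - c := by rw [hk, indicator_of_mem ht]
      simp only [this]
      ring
    rw [e4, e1, e2, e3, sub_zero, sub_zero]
  have hkk : IntervalIntegrable (fun t ↦ k t * k t) volume a b :=
    intervalIntegrable_of_norm_le (hkm.mul hkm) (C := C' * C') fun t _ ↦ by
      rw [norm_mul]
      exact mul_le_mul (hC' t) (hC' t) (norm_nonneg _) C'.2
  rw [intervalIntegral.integral_of_le hab.le] at h3
  have h4 := (setIntegral_eq_zero_iff_of_nonneg_ae (ae_of_all _ fun t ↦ mul_self_nonneg (k t))
    ((intervalIntegrable_iff_integrableOn_Ioc_of_le hab.le).1 hkk)).1 h3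
  refine ⟨c, ?_⟩
  filter_upwards [(ae_restrict_iff' measurableSet_Ioc).1 h4] with t ht hta
  have h5 : k t = 0 := by simpa using ht hta
  rw [hk, indicator_of_mem hta] at h5
  simp only [hD] at h5
  linarith

end Calculus

end RiemannianGeodesic

end

noncomputable section

namespace RiemannianGeodesic

open Set Filter Topology MeasureTheory
open scoped NNReal ENNReal

/-! ### Energy and its first variation -/

section Variation

set_option maxSynthPendingDepth 3

variable {E : Type*} [NormedAddCommGroup E]

lemma exists_norm_le_of_continuous_isCompact_range {F : Type*} [NormedAddCommGroup F]
    {g : E → F} {u : ℝ → E} (hg : ContinuousOn g (range u)) (hu : IsCompact (range u)) :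
    ∃ C : ℝ≥0, ∀ t, ‖g (u t)‖ ≤ C := by
  obtain ⟨C, hC⟩ := hu.exists_bound_of_continuousOn hg
  exact ⟨C.toNNReal, fun t ↦ (hC _ (mem_range_self t)).trans (Real.le_coe_toNNReal C)⟩

variable [NormedSpace ℝ E]

lemma aestronglyMeasurable_form {g : ℝ → E →L[ℝ] E →L[ℝ] ℝ} {p q : ℝ → E}
    (hg : AEStronglyMeasurable g) (hp : AEStronglyMeasurable p) (hq : AEStronglyMeasurable q) :
    AEStronglyMeasurable fun t ↦ g t (p t) (q t) := by
  have : Continuous fun x : (E →L[ℝ] E →L[ℝ] ℝ) × E × E ↦ x.1 x.2.1 x.2.2 := by fun_prop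
  exact this.comp_aestronglyMeasurable (hg.prodMk (hp.prodMk hq))

lemma norm_form_le {g : E →L[ℝ] E →L[ℝ] ℝ} {p q : E} {C K K' : ℝ} (hC : 0 ≤ C) (hK : 0 ≤ K)
    (hg : ‖g‖ ≤ C) (hp : ‖p‖ ≤ K) (hq : ‖q‖ ≤ K') : ‖g p q‖ ≤ C * K * K' :=
  (g.le_opNorm₂ p q).trans (by gcongr)

variable [FiniteDimensional ℝ E] {G : E → E →L[ℝ] E →L[ℝ] ℝ} {Ω : Set E}

lemma intervalIntegrable_form {v : ℝ → E} {K : ℝ≥0} {a b : ℝ} (hG : ContinuousOn G Ω)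
    (hpos : ∀ z ∈ Ω, ∀ w, 0 ≤ G z w w) (hv : LipschitzWith K v) (hvΩ : ∀ t, v t ∈ Ω) :
    IntervalIntegrable (fun t ↦ G (v t) (deriv v t) (deriv v t)) volume a b ∧
      IntervalIntegrable (fun t ↦ √(G (v t) (deriv v t) (deriv v t))) volume a b := by
  have hGv : Continuous fun t ↦ G (v t) := hG.comp_continuous hv.continuous hvΩ
  obtain ⟨C, hC⟩ := isCompact_uIcc.exists_bound_of_continuousOn (s := uIcc a b) hGv.continuousOn
  have hd : AEStronglyMeasurable (deriv v) := aestronglyMeasurable_deriv _ _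
  have hm := aestronglyMeasurable_form hGv.aestronglyMeasurable hd hd
  set Q : ℝ → ℝ := fun t ↦ G (v t) (deriv v t) (deriv v t) with hQ
  have hQ0 : ∀ t, 0 ≤ Q t := fun t ↦ hpos _ (hvΩ t) _
  have hQC : ∀ t ∈ uIoc a b, ‖Q t‖ ≤ max C 0 * K * K := fun t ht ↦
    norm_form_le (le_max_right _ _) K.2
      ((hC t (uIoc_subset_uIcc ht)).trans (le_max_left _ _))
      (norm_deriv_le_of_lipschitz hv) (norm_deriv_le_of_lipschitz hv)
  have hi : IntervalIntegrable Q volume a b := intervalIntegrable_of_norm_le hm hQC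
  have hi' : IntervalIntegrable (fun t ↦ √(Q t)) volume a b := by
    refine intervalIntegrable_of_norm_le (C := 1 + max C 0 * K * K)
      (Real.continuous_sqrt.comp_aestronglyMeasurable hm) fun t ht ↦ ?_
    rw [Real.norm_of_nonneg (Real.sqrt_nonneg _)]
    have h1 := hQC t ht
    rw [Real.norm_of_nonneg (hQ0 t)] at h1
    nlinarith [Real.sq_sqrt (hQ0 t), sq_nonneg (√(Q t) - 1), Real.sqrt_nonneg (Q t)]
  exact ⟨hi, hi'⟩

/-- By the Cauchy-Schwarz inequality, a lower bound on the length gives a lower bound on the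
energy. -/
lemma sq_mul_le_energy {v : ℝ → E} {K : ℝ≥0} {a b ℓ : ℝ} (hab : a ≤ b) (hG : ContinuousOn G Ω)
    (hpos : ∀ z ∈ Ω, ∀ w, 0 ≤ G z w w) (hv : LipschitzWith K v) (hvΩ : ∀ t, v t ∈ Ω)
    (h : ℓ * (b - a) ≤ ∫ t in a..b, √(G (v t) (deriv v t) (deriv v t))) (hℓ : 0 ≤ ℓ) :
    ℓ ^ 2 * (b - a) ≤ ∫ t in a..b, G (v t) (deriv v t) (deriv v t) := by
  obtain ⟨hi, hi'⟩ := intervalIntegrable_form (a := a) (b := b) hG hpos hv hvΩ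
  set Q : ℝ → ℝ := fun t ↦ G (v t) (deriv v t) (deriv v t) with hQ
  have hQ0 : ∀ t, 0 ≤ Q t := fun t ↦ hpos _ (hvΩ t) _
  -- Pointwise, 2ℓ√Q ≤ ℓ² + Q is the square (√Q - ℓ)² ≥ 0; no integral Cauchy-Schwarz is needed.
  have h1 : ∫ t in a..b, 2 * ℓ * √(Q t) ≤ ∫ t in a..b, (ℓ ^ 2 + Q t) := by
    refine intervalIntegral.integral_mono_on hab (hi'.const_mul _)
      (intervalIntegrable_const.add hi) fun t _ ↦ ?_
    nlinarith [Real.sq_sqrt (hQ0 t), sq_nonneg (√(Q t) - ℓ)]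
  rw [intervalIntegral.integral_const_mul, intervalIntegral.integral_add intervalIntegrable_const
    hi, intervalIntegral.integral_const, smul_eq_mul] at h1
  have h2 := mul_le_mul_of_nonneg_left h (by positivity : 0 ≤ 2 * ℓ)
  nlinarith

/-- The first variation formula for a curve that minimizes the length with respect to a
Riemannian metric `G` and has at most constant speed `ℓ`. -/
lemma integral_first_variation_eq_zero {u : ℝ → E} {K : ℝ≥0} {a b ℓ : ℝ} (hab : a ≤ b)
    (hΩ : IsOpen Ω) (hG : ContDiffOn ℝ ∞ G Ω) (hsymm : ∀ z v w, G z v w = G z w v)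
    (hpos : ∀ z ∈ Ω, ∀ w, 0 ≤ G z w w) (hu : LipschitzWith K u) (huΩ : ∀ t, u t ∈ Ω)
    (huc : IsCompact (range u)) (hℓ : 0 ≤ ℓ)
    (hspeed : ∀ᵐ t, t ∈ Ioc a b → G (u t) (deriv u t) (deriv u t) ≤ ℓ ^ 2)
    (hmin : ∀ (v : ℝ → E) (K' : ℝ≥0), LipschitzWith K' v → (∀ t ∉ Ioo a b, v t = u t) →
      (∀ t, v t ∈ Ω) → ℓ * (b - a) ≤ ∫ t in a..b, √(G (v t) (deriv v t) (deriv v t)))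
    {η : ℝ → ℝ} {K' : ℝ≥0} (hη : LipschitzWith K' η) (hη0 : ∀ t ∉ Ioo a b, η t = 0) (w : E) :
    ∫ t in a..b, (fderiv ℝ G (u t) w (deriv u t) (deriv u t) * η t +
      2 * G (u t) (deriv u t) w * deriv η t) = 0 := by
  have : ProperSpace E := FiniteDimensional.proper_real E
  obtain ⟨δ, hδ, hδΩ⟩ := huc.exists_cthickening_subset_open hΩ (range_subset_iff.2 huΩ)
  have hKc : IsCompact (Metric.cthickening δ (range u)) := huc.cthickening
  obtain ⟨C₀, hC₀⟩ := hKc.exists_bound_of_continuousOn (hG.continuousOn.mono hδΩ)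
  have hGd : ContinuousOn (fderiv ℝ G) Ω := hG.continuousOn_fderiv_of_isOpen hΩ (by simp)
  obtain ⟨C₁, hC₁⟩ := hKc.exists_bound_of_continuousOn (hGd.mono hδΩ)
  obtain ⟨Cη, hCη⟩ : ∃ Cη, ∀ t, ‖η t‖ ≤ Cη := by
    obtain ⟨C, hC⟩ := isCompact_Icc.exists_bound_of_continuousOn (s := Icc a b)
      hη.continuous.continuousOn
    refine ⟨max C 0, fun t ↦ ?_⟩
    by_cases ht : t ∈ Ioo a b
    · exact (hC t (Ioo_subset_Icc_self ht)).trans (le_max_left _ _)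
    · simp [hη0 t ht]
  have hCη0 : 0 ≤ Cη := (norm_nonneg _).trans (hCη 0)
  have hw0 := norm_nonneg w
  -- For |ε| < ε₀ the varied curves stay in a compact thickening of the range of `u` inside `Ω`,
  -- where `G` and its derivative are bounded.
  obtain ⟨ε₀, hε₀, hε₀δ⟩ : ∃ ε₀ > 0, ε₀ * (Cη * ‖w‖) ≤ δ := by
    refine ⟨δ / (Cη * ‖w‖ + 1), by positivity, ?_⟩
    rw [div_mul_eq_mul_div, div_le_iff₀ (by positivity)]
    nlinarith [mul_nonneg hCη0 hw0]
  set p := deriv u with hp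
  set q := deriv η with hq
  have hpK : ∀ t, ‖p t‖ ≤ K := fun t ↦ norm_deriv_le_of_lipschitz hu
  have hqK : ∀ t, ‖q t‖ ≤ K' := fun t ↦ norm_deriv_le_of_lipschitz hη
  have hpm : AEStronglyMeasurable p := aestronglyMeasurable_deriv _ _
  have hqm : AEStronglyMeasurable q := aestronglyMeasurable_deriv _ _
  let V : ℝ → ℝ → E := fun ε t ↦ u t + (ε * η t) • w
  let P : ℝ → ℝ → E := fun ε t ↦ p t + (ε * q t) • w
  let J : ℝ → ℝ → ℝ := fun ε t ↦ G (V ε t) (P ε t) (P ε t)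
  let J' : ℝ → ℝ → ℝ := fun ε t ↦ (fderiv ℝ G (V ε t) (η t • w) (P ε t) +
    G (V ε t) (q t • w)) (P ε t) + G (V ε t) (P ε t) (q t • w)
  have hVmem : ∀ ε ∈ Metric.ball (0 : ℝ) ε₀, ∀ t, V ε t ∈ Metric.cthickening δ (range u) := by
    intro ε hε t
    refine Metric.mem_cthickening_of_dist_le _ (u t) _ _ (mem_range_self t) ?_
    rw [dist_eq_norm, add_sub_cancel_left, norm_smul, norm_mul, mul_assoc]
    refine le_trans ?_ hε₀δ
    rw [mem_ball_zero_iff] at hε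
    have := hCη t
    gcongr
  have hVΩ : ∀ ε ∈ Metric.ball (0 : ℝ) ε₀, ∀ t, V ε t ∈ Ω := fun ε hε t ↦ hδΩ (hVmem ε hε t)
  have hVc : ∀ ε, Continuous (V ε) := fun ε ↦
    hu.continuous.add ((continuous_const.mul hη.continuous).smul continuous_const)
  have hPm : ∀ ε, AEStronglyMeasurable (P ε) := fun ε ↦
    hpm.add ((hqm.const_mul ε).smul_const w)
  have hball : Metric.ball (0 : ℝ) ε₀ ∈ 𝓝 0 := Metric.ball_mem_nhds _ hε₀
  have h0 : (0 : ℝ) ∈ Metric.ball (0 : ℝ) ε₀ := Metric.mem_ball_self hε₀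
  have hJm : ∀ ε ∈ Metric.ball (0 : ℝ) ε₀, AEStronglyMeasurable (J ε) := fun ε hε ↦
    aestronglyMeasurable_form (hG.continuousOn.comp_continuous (hVc ε)
      (hVΩ ε hε)).aestronglyMeasurable (hPm ε) (hPm ε)
  have hPK : ∀ ε ∈ Metric.ball (0 : ℝ) ε₀, ∀ t, ‖P ε t‖ ≤ K + ε₀ * K' * ‖w‖ := by
    intro ε hε t
    refine (norm_add_le _ _).trans (add_le_add (hpK t) ?_)
    rw [norm_smul, norm_mul]
    rw [mem_ball_zero_iff] at hε
    have := hqK t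
    gcongr
  have hGC : ∀ ε ∈ Metric.ball (0 : ℝ) ε₀, ∀ t, ‖G (V ε t)‖ ≤ C₀ := fun ε hε t ↦
    hC₀ _ (hVmem ε hε t)
  have hC₀0 : 0 ≤ C₀ := (norm_nonneg _).trans (hGC 0 h0 0)
  have hGC' : ∀ ε ∈ Metric.ball (0 : ℝ) ε₀, ∀ t, ‖fderiv ℝ G (V ε t)‖ ≤ C₁ := fun ε hε t ↦
    hC₁ _ (hVmem ε hε t)
  have hC₁0 : 0 ≤ C₁ := (norm_nonneg _).trans (hGC' 0 h0 0)
  set Pm : ℝ := K + ε₀ * K' * ‖w‖ with hPm_def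
  have hPm0 : 0 ≤ Pm := by positivity
  have hηw : ∀ t, ‖η t • w‖ ≤ Cη * ‖w‖ := fun t ↦ by
    rw [norm_smul]
    have := hCη t
    gcongr
  have hqw : ∀ t, ‖q t • w‖ ≤ K' * ‖w‖ := fun t ↦ by
    rw [norm_smul]
    have := hqK t
    gcongr
  -- Differentiation of the energy under the integral sign; the dominating function is constant
  -- since all velocities are bounded.
  have hderiv := intervalIntegral.hasDerivAt_integral_of_dominated_loc_of_deriv_le (𝕜 := ℝ)
    (μ := volume) (a := a) (b := b) (F := J) (F' := J') (x₀ := 0)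
    (bound := fun _ ↦ C₁ * (Cη * ‖w‖) * Pm * Pm + C₀ * (K' * ‖w‖) * Pm + C₀ * Pm * (K' * ‖w‖))
    hball (Filter.eventually_of_mem hball fun ε hε ↦ (hJm ε hε).restrict)
    (intervalIntegrable_of_norm_le (hJm 0 h0) fun t _ ↦
      norm_form_le hC₀0 hPm0 (hGC 0 h0 t) (hPK 0 h0 t) (hPK 0 h0 t))
    (by
      have h1 : Continuous fun t ↦ fderiv ℝ G (V 0 t) :=
        hGd.comp_continuous (hVc 0) (hVΩ 0 h0)
      have h2 : Continuous fun t ↦ G (V 0 t) :=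
        hG.continuousOn.comp_continuous (hVc 0) (hVΩ 0 h0)
      have h3 : Continuous fun t ↦ fderiv ℝ G (V 0 t) (η t • w) :=
        h1.clm_apply (hη.continuous.smul continuous_const)
      have h4 := aestronglyMeasurable_form h3.aestronglyMeasurable (hPm 0) (hPm 0)
      have h5 := aestronglyMeasurable_form h2.aestronglyMeasurable (hqm.smul_const w) (hPm 0)
      have h6 := aestronglyMeasurable_form h2.aestronglyMeasurable (hPm 0) (hqm.smul_const w)
      exact ((h4.add h5).add h6).restrict)
    (ae_of_all _ fun t _ ε hε ↦ by
      simp only [J', add_apply]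
      refine (norm_add_le _ _).trans (add_le_add ((norm_add_le _ _).trans (add_le_add ?_ ?_)) ?_)
      · refine norm_form_le (by positivity) hPm0 ?_ (hPK ε hε t) (hPK ε hε t)
        exact ((fderiv ℝ G (V ε t)).le_opNorm _).trans
          (mul_le_mul (hGC' ε hε t) (hηw t) (norm_nonneg _) hC₁0)
      · exact norm_form_le hC₀0 (by positivity) (hGC ε hε t) (hqw t) (hPK ε hε t)
      · exact norm_form_le hC₀0 hPm0 (hGC ε hε t) (hPK ε hε t) (hqw t))
    intervalIntegrable_const
    (ae_of_all _ fun t _ ε hε ↦ by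
      have h1 : HasDerivAt (fun ε ↦ V ε t) (η t • w) ε := by
        simpa [V] using (((hasDerivAt_id ε).mul_const (η t)).smul_const w).const_add (u t)
      have h2 : HasDerivAt (fun ε ↦ P ε t) (q t • w) ε := by
        simpa [P] using (((hasDerivAt_id ε).mul_const (q t)).smul_const w).const_add (p t)
      have h3 : HasFDerivAt G (fderiv ℝ G (V ε t)) (V ε t) :=
        ((hG.contDiffAt (hΩ.mem_nhds (hVΩ ε hε t))).differentiableAt (by simp)).hasFDerivAt
      have h4 : HasDerivAt (fun ε ↦ G (V ε t)) (fderiv ℝ G (V ε t) (η t • w)) ε :=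
        h3.comp_hasDerivAt ε h1
      exact (h4.clm_apply h2).clm_apply h2)
  -- The speed bound gives `u` energy at most ℓ²(b - a), and `sq_mul_le_energy` gives each variation
  -- at least that much. Thus an upper bound on the speed is enough; constancy is not assumed.
  have hloc : IsLocalMin (fun ε ↦ ∫ t in a..b, J ε t) 0 := by
    refine Filter.eventually_of_mem hball fun ε hε ↦ ?_
    have hu0 : ∫ t in a..b, J 0 t ≤ ℓ ^ 2 * (b - a) := by
      have : ∫ t in a..b, J 0 t ≤ ∫ t in a..b, ℓ ^ 2 := by
        refine intervalIntegral.integral_mono_ae_restrict hab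
          (intervalIntegrable_of_norm_le (hJm 0 h0) fun t _ ↦
            norm_form_le hC₀0 hPm0 (hGC 0 h0 t) (hPK 0 h0 t) (hPK 0 h0 t))
          intervalIntegrable_const ?_
        rw [← restrict_Ioc_eq_restrict_Icc]
        filter_upwards [(ae_restrict_iff' measurableSet_Ioc).2 hspeed] with t ht
        simpa [J, V, P] using ht
      rw [intervalIntegral.integral_const, smul_eq_mul, mul_comm] at this
      exact this
    refine hu0.trans ?_
    have hVL : LipschitzWith (K + ‖ε‖₊ * K' * ‖w‖₊) (V ε) := by
      refine hu.add (LipschitzWith.of_dist_le_mul fun s t ↦ ?_)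
      rw [dist_eq_norm, ← sub_smul, ← mul_sub, norm_smul, norm_mul, ← dist_eq_norm (η s)]
      have := hη.dist_le_mul s t
      push_cast
      calc ‖ε‖ * dist (η s) (η t) * ‖w‖ ≤ ‖ε‖ * (K' * dist s t) * ‖w‖ := by gcongr
        _ = _ := by ring
    have hVu : ∀ t ∉ Ioo a b, V ε t = u t := fun t ht ↦ by simp [V, hη0 t ht]
    have := sq_mul_le_energy hab hG.continuousOn hpos hVL (hVΩ ε hε)
      (hmin _ _ hVL hVu (hVΩ ε hε)) hℓ
    refine this.trans (le_of_eq (intervalIntegral.integral_congr_ae ?_))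
    filter_upwards [hu.ae_differentiableAt, hη.ae_differentiableAt] with t ht ht' _
    have h1 : HasDerivAt (V ε) (P ε t) t := by
      exact ht.hasDerivAt.add ((ht'.hasDerivAt.const_mul ε).smul_const w)
    simp only [J]
    rw [h1.deriv]
  have hzero := hloc.hasDerivAt_eq_zero hderiv.2
  rw [← hzero]
  refine intervalIntegral.integral_congr fun t _ ↦ ?_
  simp only [J', V, P, zero_mul, zero_smul, add_zero, map_smul, smul_eq_mul,
    add_apply, smul_apply]
  rw [hsymm (u t) w (p t)]
  ring

end Variation

end RiemannianGeodesic

end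

noncomputable section

namespace RiemannianGeodesic

open Set Filter Topology MeasureTheory
open scoped NNReal ENNReal

/-! ### Regularity of minimizers and the geodesic equation -/

section Regularity

set_option maxSynthPendingDepth 3

lemma contDiffOn_succ_of_hasDerivWithinAt {F : Type*} [NormedAddCommGroup F] [NormedSpace ℝ F]
    {f f' : ℝ → F} {a b : ℝ} (hab : a < b) {m : ℕ}
    (hf : ∀ t ∈ Icc a b, HasDerivWithinAt f (f' t) (Icc a b) t)
    (hf' : ContDiffOn ℝ m f' (Icc a b)) : ContDiffOn ℝ (m + 1) f (Icc a b) := by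
  have hu := uniqueDiffOn_Icc hab
  refine (contDiffOn_succ_iff_derivWithin hu).2
    ⟨fun t ht ↦ (hf t ht).differentiableWithinAt, fun h ↦ by simp at h, ?_⟩
  exact hf'.congr fun t ht ↦ (hf t ht).derivWithin (hu t ht)

variable {E : Type*} [NormedAddCommGroup E] [NormedSpace ℝ E] [FiniteDimensional ℝ E]
  {G : E → E →L[ℝ] E →L[ℝ] ℝ} {Ω : Set E}

/-- Positivity gives injectivity, and E and its dual have the same dimension. -/
lemma isInvertible_of_forall_pos {g : E →L[ℝ] E →L[ℝ] ℝ} (h : ∀ v, v ≠ 0 → 0 < g v v) :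
    g.IsInvertible := by
  have hinj : Function.Injective (g : E →ₗ[ℝ] E →L[ℝ] ℝ) := by
    refine (injective_iff_map_eq_zero _).2 fun v hv ↦ ?_
    by_contra hne
    have h1 := h v hne
    have h2 : g v = 0 := hv
    rw [h2] at h1
    simp at h1
  have hdim : Module.finrank ℝ E = Module.finrank ℝ (E →L[ℝ] ℝ) := by
    rw [← (LinearMap.toContinuousLinearMap (𝕜 := ℝ) (E := E) (F' := ℝ)).finrank_eq]
    exact (Subspace.dual_finrank_eq (K := ℝ) (V := E)).symm
  let e := (LinearMap.linearEquivOfInjective (g : E →ₗ[ℝ] E →L[ℝ] ℝ) hinj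
    hdim).toContinuousLinearEquiv
  refine ⟨e, ?_⟩
  ext v w
  rfl

/-- A curve of bounded speed that minimizes the length satisfies the integrated Euler-Lagrange
equation almost everywhere. -/
lemma exists_ae_momentum_eq {u : ℝ → E} {K : ℝ≥0} {a b ℓ : ℝ} (hab : a < b)
    (hΩ : IsOpen Ω) (hG : ContDiffOn ℝ ∞ G Ω) (hsymm : ∀ z v w, G z v w = G z w v)
    (hpos : ∀ z ∈ Ω, ∀ w, 0 ≤ G z w w) (hu : LipschitzWith K u) (huΩ : ∀ t, u t ∈ Ω)
    (huc : IsCompact (range u)) (hℓ : 0 ≤ ℓ)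
    (hspeed : ∀ᵐ t, t ∈ Ioc a b → G (u t) (deriv u t) (deriv u t) ≤ ℓ ^ 2)
    (hmin : ∀ (v : ℝ → E) (K' : ℝ≥0), LipschitzWith K' v → (∀ t ∉ Ioo a b, v t = u t) →
      (∀ t, v t ∈ Ω) → ℓ * (b - a) ≤ ∫ t in a..b, √(G (v t) (deriv v t) (deriv v t))) (w : E) :
    ∃ c : ℝ, ∀ᵐ t, t ∈ Ioc a b → 2 * G (u t) (deriv u t) w =
      c + ∫ s in a..t, fderiv ℝ G (u s) w (deriv u s) (deriv u s) := by
  have hGd : ContinuousOn (fderiv ℝ G) Ω := hG.continuousOn_fderiv_of_isOpen hΩ (by simp)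
  have hrange : range u ⊆ Ω := range_subset_iff.2 huΩ
  obtain ⟨C₀, hC₀⟩ := exists_norm_le_of_continuous_isCompact_range (hG.continuousOn.mono hrange) huc
  obtain ⟨C₁, hC₁⟩ := exists_norm_le_of_continuous_isCompact_range (hGd.mono hrange) huc
  have hpK : ∀ t, ‖deriv u t‖ ≤ K := fun t ↦ norm_deriv_le_of_lipschitz hu
  have hpm : AEStronglyMeasurable (deriv u) := aestronglyMeasurable_deriv _ _
  have h1 : Continuous fun t ↦ fderiv ℝ G (u t) := hGd.comp_continuous hu.continuous huΩ
  have h2 : Continuous fun t ↦ G (u t) := hG.continuousOn.comp_continuous hu.continuous huΩ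
  refine ae_eq_const_add_integral_of_forall_lipschitz hab
    (aestronglyMeasurable_form (h1.clm_apply continuous_const).aestronglyMeasurable hpm hpm)
    ((aestronglyMeasurable_form h2.aestronglyMeasurable hpm
      aestronglyMeasurable_const).const_mul 2)
    (C := C₁ * ‖w‖₊ * K * K + 2 * (C₀ * K * ‖w‖₊)) (fun t ↦ ?_) (fun t ↦ ?_)
    fun η K' hη hη0 ↦ integral_first_variation_eq_zero hab.le hΩ hG hsymm hpos hu huΩ huc hℓ
      hspeed hmin hη hη0 w
  · have : ‖fderiv ℝ G (u t) w‖ ≤ C₁ * ‖w‖ :=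
      ((fderiv ℝ G (u t)).le_opNorm w).trans
        (mul_le_mul_of_nonneg_right (hC₁ t) (norm_nonneg w))
    refine (norm_form_le (by positivity) K.2 this (hpK t) (hpK t)).trans ?_
    push_cast
    exact le_add_of_nonneg_right (by positivity)
  · rw [norm_mul, Real.norm_two]
    refine (mul_le_mul_of_nonneg_left
      (norm_form_le C₀.2 K.2 (hC₀ t) (hpK t) le_rfl) zero_le_two).trans ?_
    push_cast
    exact le_add_of_nonneg_left (by positivity)

/-- A Lipschitz curve that satisfies the integrated Euler-Lagrange equation almost everywhere is
smooth and satisfies the geodesic equation. -/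
lemma contDiffOn_and_geodesic_of_ae_momentum_eq {u : ℝ → E} {K : ℝ≥0} {a b : ℝ} (hab : a < b)
    (hΩ : IsOpen Ω) (hG : ContDiffOn ℝ ∞ G Ω)
    (hpos : ∀ z ∈ Ω, ∀ w, w ≠ 0 → 0 < G z w w) (hu : LipschitzWith K u) (huΩ : ∀ t, u t ∈ Ω)
    (huc : IsCompact (range u))
    (heq : ∀ w, ∃ c : ℝ, ∀ᵐ t, t ∈ Ioc a b → 2 * G (u t) (deriv u t) w =
      c + ∫ s in a..t, fderiv ℝ G (u s) w (deriv u s) (deriv u s)) :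
    ContDiffOn ℝ ∞ u (Icc a b) ∧ ∀ t ∈ Ioo a b, ∀ w, G (u t) (deriv (deriv u) t) w +
      fderiv ℝ G (u t) (deriv u t) (deriv u t) w -
      fderiv ℝ G (u t) w (deriv u t) (deriv u t) / 2 = 0 := by
  have hGd : ContDiffOn ℝ ∞ (fderiv ℝ G) Ω := hG.fderiv_of_isOpen hΩ (by simp)
  obtain ⟨C₁, hC₁⟩ := exists_norm_le_of_continuous_isCompact_range
    (hGd.continuousOn.mono (range_subset_iff.2 huΩ)) huc
  choose c hc using heq
  set p := deriv u with hp
  have hpK : ∀ t, ‖p t‖ ≤ K := fun t ↦ norm_deriv_le_of_lipschitz hu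
  have hpm : AEStronglyMeasurable p := aestronglyMeasurable_deriv _ _
  let e := Module.finBasis ℝ E
  let co : Fin (Module.finrank ℝ E) → E →L[ℝ] ℝ := fun i ↦
    LinearMap.toContinuousLinearMap (e.coord i)
  -- Expansion in the dual basis: only finitely many of the almost everywhere equations are needed,
  -- so a single null set serves for all `w`.
  have hco : ∀ (L : E →L[ℝ] ℝ), L = ∑ i, L (e i) • co i := fun L ↦ by
    refine ContinuousLinearMap.coe_injective (e.ext fun j ↦ ?_)
    simp [co, Finsupp.single_apply]
  have hGinv : ∀ z ∈ Ω, (G z).IsInvertible := fun z hz ↦ isInvertible_of_forall_pos (hpos z hz)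
  have hinv : ContDiffOn ℝ ∞ (fun z ↦ ContinuousLinearMap.inverse (G z)) Ω := by
    intro z hz
    obtain ⟨A, hA⟩ := hGinv z hz
    have h1 : ContDiffAt ℝ ∞ ContinuousLinearMap.inverse (G z) := by
      rw [← hA]
      exact contDiffAt_map_inverse A
    exact h1.comp_contDiffWithinAt z (hG z hz)
  have hGu : Continuous fun t ↦ fderiv ℝ G (u t) :=
    hGd.continuousOn.comp_continuous hu.continuous huΩ
  have hΛ₀c : ∀ i, Continuous fun t ↦ ∫ s in a..t, fderiv ℝ G (u s) (e i) (p s) (p s) := fun i ↦ by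
    refine (lipschitzWith_integral_of_norm_le (C := C₁ * ‖e i‖₊ * K * K) a
      (aestronglyMeasurable_form (hGu.clm_apply continuous_const).aestronglyMeasurable hpm hpm)
      fun t ↦ ?_).continuous
    have : ‖fderiv ℝ G (u t) (e i)‖ ≤ C₁ * ‖e i‖ :=
      ((fderiv ℝ G (u t)).le_opNorm _).trans (mul_le_mul_of_nonneg_right (hC₁ t) (norm_nonneg _))
    refine (norm_form_le (by positivity) K.2 this (hpK t) (hpK t)).trans (le_of_eq ?_)
    push_cast
    rfl
  set Λ : ℝ → E →L[ℝ] ℝ := fun t ↦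
    ∑ i, (c (e i) + ∫ s in a..t, fderiv ℝ G (u s) (e i) (p s) (p s)) • co i with hΛ
  have hΛc : Continuous Λ := continuous_finsetSum _ fun i _ ↦
    (continuous_const.add (hΛ₀c i)).smul continuous_const
  -- The momentum equation solved for the velocity; 1/2 undoes the factor 2 of the momentum. `V` is
  -- continuous and agrees almost everywhere with the derivative of `u`.
  set V : ℝ → E := fun t ↦ (1 / 2 : ℝ) • ContinuousLinearMap.inverse (G (u t)) (Λ t) with hV
  have hVc : Continuous V :=
    ((hinv.continuousOn.comp_continuous hu.continuous huΩ).clm_apply hΛc).const_smul _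
  have hGV : ∀ t w, 2 * G (u t) (V t) w = Λ t w := fun t w ↦ by
    obtain ⟨A, hA⟩ := hGinv _ (huΩ t)
    simp only [hV, ← hA, ContinuousLinearMap.inverse_equiv]
    simp
  have hpV : ∀ᵐ t, t ∈ Ioc a b → p t = V t := by
    have : ∀ᵐ t, ∀ i, t ∈ Ioc a b → 2 * G (u t) (p t) (e i) =
        c (e i) + ∫ s in a..t, fderiv ℝ G (u s) (e i) (p s) (p s) := ae_all_iff.2 fun i ↦ hc (e i)
    filter_upwards [this] with t ht htab
    have h1 : (2 : ℝ) • G (u t) (p t) = Λ t := by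
      rw [hco ((2 : ℝ) • G (u t) (p t))]
      simp only [hΛ]
      refine Finset.sum_congr rfl fun i _ ↦ ?_
      rw [← ht i htab]
      simp
    obtain ⟨A, hA⟩ := hGinv _ (huΩ t)
    simp only [hV, ← h1, ← hA, ContinuousLinearMap.inverse_equiv]
    simp
  have hVi : ∀ t, HasDerivAt (fun t ↦ ∫ s in a..t, V s) (V t) t := fun t ↦
    (hVc.integral_hasStrictDerivAt a t).hasDerivAt
  have huV : ∀ t ∈ Icc a b, u t = u a + ∫ s in a..t, V s := by
    have h1 : AbsolutelyContinuousOnInterval (fun t ↦ ∫ s in a..t, V s) a b := by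
      refine ContDiffOn.absolutelyContinuousOnInterval (ContDiff.contDiffOn ?_)
      refine contDiff_one_iff_deriv.2 ⟨fun t ↦ (hVi t).differentiableAt, ?_⟩
      convert hVc using 1
      ext1 t
      exact (hVi t).deriv
    -- The difference of `u` and the primitive of `V` is absolutely continuous with derivative zero
    -- almost everywhere, hence constant; so `u` is C¹ with velocity `V` everywhere.
    have h2 := (hu.lipschitzOnWith (s := uIcc a b)).absolutelyContinuousOnInterval.sub h1
    have hne : ∀ᵐ t : ℝ, t ≠ a := compl_mem_ae_iff.2 (measure_singleton a)
    obtain ⟨C, hC⟩ := h2.const_of_ae_hasDerivAt_zero (by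
      filter_upwards [hpV, hu.ae_differentiableAt, hne] with t h3 h4 h5 h6
      rw [uIcc_of_le hab.le] at h6
      have h7 := h4.hasDerivAt.sub (hVi t)
      rwa [← hp, h3 ⟨lt_of_le_of_ne h6.1 (Ne.symm h5), h6.2⟩, sub_self] at h7)
    rw [uIcc_of_le hab.le] at hC
    intro t ht
    have h3 := hC t ht
    have h4 := hC a (left_mem_Icc.2 hab.le)
    simp only [Pi.sub_apply, intervalIntegral.integral_same, sub_zero] at h3 h4
    rw [h4, ← h3, sub_add_cancel]
  have hud : ∀ t ∈ Icc a b, HasDerivWithinAt u (V t) (Icc a b) t := fun t ht ↦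
    ((hVi t).const_add (u a)).hasDerivWithinAt.congr (fun s hs ↦ huV s hs) (huV t ht)
  -- The integrand of the momentum with the measurable derivative replaced by `V`, so that its
  -- regularity follows that of `V`.
  let A : Fin (Module.finrank ℝ E) → ℝ → ℝ := fun i s ↦ fderiv ℝ G (u s) (e i) (V s) (V s)
  have hAc : ∀ i, Continuous (A i) := fun i ↦
    ((hGu.clm_apply continuous_const).clm_apply hVc).clm_apply hVc
  let I : Fin (Module.finrank ℝ E) → ℝ → ℝ := fun i t ↦ ∫ s in a..t, A i s
  have hId : ∀ i t, HasDerivAt (I i) (A i t) t := fun i t ↦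
    ((hAc i).integral_hasStrictDerivAt a t).hasDerivAt
  have hΛI : ∀ t ∈ Icc a b, Λ t = ∑ i, (c (e i) + I i t) • co i := fun t ht ↦ by
    simp only [hΛ, I]
    refine Finset.sum_congr rfl fun i _ ↦ ?_
    congr 2
    refine intervalIntegral.integral_congr_ae ?_
    filter_upwards [hpV] with s hs hs'
    rw [uIoc_of_le ht.1] at hs'
    simp only [A]
    rw [hs ⟨hs'.1, hs'.2.trans ht.2⟩]
  have hmaps : MapsTo u (Icc a b) Ω := fun t _ ↦ huΩ t
  -- Bootstrap: if `V` is C^m then `u` is C^(m+1), the integrands are C^m, the momentum is C^(m+1),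
  -- and so is `V`.
  have hsmooth : ∀ m : ℕ, ContDiffOn ℝ m V (Icc a b) := by
    intro m
    induction m with
    | zero => exact contDiffOn_zero.2 hVc.continuousOn
    | succ m ih =>
      have h1 : ContDiffOn ℝ (m + 1) u (Icc a b) := contDiffOn_succ_of_hasDerivWithinAt hab hud ih
      have h1' : ContDiffOn ℝ m u (Icc a b) := h1.of_le (by exact_mod_cast Nat.le_succ m)
      have h2 : ∀ i, ContDiffOn ℝ m (A i) (Icc a b) := fun i ↦
        ((((hGd.of_le (by exact_mod_cast le_top)).comp h1' hmaps).clm_apply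
          contDiffOn_const).clm_apply ih).clm_apply ih
      have h3 : ∀ i, ContDiffOn ℝ (m + 1) (I i) (Icc a b) := fun i ↦
        contDiffOn_succ_of_hasDerivWithinAt hab (fun t _ ↦ (hId i t).hasDerivWithinAt) (h2 i)
      have h4 : ContDiffOn ℝ (m + 1) Λ (Icc a b) := by
        refine ContDiffOn.congr ?_ hΛI
        exact ContDiffOn.sum fun i _ ↦ (contDiffOn_const.add (h3 i)).smul contDiffOn_const
      have h5 : ContDiffOn ℝ (m + 1) (fun t ↦ ContinuousLinearMap.inverse (G (u t))) (Icc a b) :=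
        (hinv.of_le (by exact_mod_cast le_top)).comp h1 hmaps
      push_cast
      exact (h5.clm_apply h4).const_smul _
  refine ⟨contDiffOn_infty.2 fun m ↦ ?_, fun t ht w ↦ ?_⟩
  · exact (contDiffOn_succ_of_hasDerivWithinAt hab hud (hsmooth m)).of_le
      (by exact_mod_cast Nat.le_succ m)
  · have hnhds : Icc a b ∈ 𝓝 t := Icc_mem_nhds ht.1 ht.2
    have h1 : ∀ s ∈ Ioo a b, HasDerivAt u (V s) s := fun s hs ↦
      (hud s (Ioo_subset_Icc_self hs)).hasDerivAt (Icc_mem_nhds hs.1 hs.2)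
    have h2 : p =ᶠ[𝓝 t] V := by
      filter_upwards [Ioo_mem_nhds ht.1 ht.2] with s hs using (h1 s hs).deriv
    have h3 : HasDerivAt V (deriv V t) t :=
      ((((hsmooth 1).contDiffAt hnhds)).differentiableAt (by simp)).hasDerivAt
    have h4 : HasFDerivAt G (fderiv ℝ G (u t)) (u t) :=
      ((hG.contDiffAt (hΩ.mem_nhds (huΩ t))).differentiableAt (by simp)).hasFDerivAt
    have h5 : HasDerivAt (fun t ↦ G (u t)) (fderiv ℝ G (u t) (V t)) t :=
      h4.comp_hasDerivAt t (h1 t ht)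
    have h6 : HasDerivAt (fun t ↦ 2 * G (u t) (V t) w) _ t :=
      (((h5.clm_apply h3).clm_apply (hasDerivAt_const t w)).const_mul 2)
    have h7 : HasDerivAt (fun t ↦ ∑ i, (c (e i) + I i t) * co i w) (∑ i, A i t * co i w) t :=
      HasDerivAt.fun_sum fun i _ ↦ ((hId i t).const_add _).mul_const _
    -- Both sides of the momentum identity are now differentiable; comparing their derivatives gives
    -- the geodesic equation.
    have h8 : (fun t ↦ 2 * G (u t) (V t) w) =ᶠ[𝓝 t] fun t ↦ ∑ i, (c (e i) + I i t) * co i w := by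
      filter_upwards [hnhds] with s hs
      rw [hGV, hΛI s hs]
      simp
    have h9 := (h7.congr_of_eventuallyEq h8).unique h6
    have h10 : ∑ i, A i t * co i w = fderiv ℝ G (u t) w (V t) (V t) := by
      let L : E →L[ℝ] ℝ := ((fderiv ℝ G (u t)).flip (V t)).flip (V t)
      have := congrArg (fun L : E →L[ℝ] ℝ ↦ L w) (hco L)
      simpa [L, A] using this.symm
    rw [h10] at h9
    rw [h2.deriv_eq, h2.eq_of_nhds, h9]
    simp
    ring

end Regularity

end RiemannianGeodesic

end

noncomputable section

namespace RiemannianGeodesic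

open Set Filter Topology MeasureTheory
open scoped NNReal ENNReal

/-! ### Comparing the distance with the metric in a chart -/

section ChartDistance

set_option maxSynthPendingDepth 3

variable {n : ℕ} {M : Type*} [MetricSpace M]
    [ChartedSpace (EuclideanSpace ℝ (Fin n)) M]
    [RiemannianBundle (fun q : M ↦ TangentSpace (𝓡 n) q)]

lemma norm_tangentSpace_congr {q q' : M} (h : q = q') (v : EuclideanSpace ℝ (Fin n)) :
    norm (E := TangentSpace (𝓡 n) q) v = norm (E := TangentSpace (𝓡 n) q') v := by
  rw [h]

lemma abs_chartForm_le (p : M) (z v w : EuclideanSpace ℝ (Fin n)) :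
    |chartForm p z v w| ≤ √(chartForm p z v v) * √(chartForm p z w w) := by
  rw [sqrt_chartForm_self, sqrt_chartForm_self, chartForm_apply, chartMetric]
  exact abs_real_inner_le_norm _ _

variable [IsManifold (𝓡 n) ∞ M]

/-- The speed of a curve, computed in a chart. -/
lemma norm_mfderiv_eq_sqrt_chartForm {p : M} {u : ℝ → EuclideanSpace ℝ (Fin n)}
    {w : EuclideanSpace ℝ (Fin n)} {c : ℝ → M} {t : ℝ} (hu : HasDerivAt u w t)
    (hz : u t ∈ (extChartAt (𝓡 n) p).target)
    (hc : c =ᶠ[𝓝 t] fun s ↦ (extChartAt (𝓡 n) p).symm (u s)) :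
    ‖mfderiv 𝓘(ℝ, ℝ) (𝓡 n) c t 1‖ = √(chartForm p (u t) w w) := by
  have h1 : MDifferentiableAt (𝓡 n) (𝓡 n) (extChartAt (𝓡 n) p).symm (u t) :=
    ((contMDiffOn_extChartAt_symm (n := ∞) p).contMDiffAt
      ((isOpen_extChartAt_target p).mem_nhds hz)).mdifferentiableAt (by simp)
  have h2 : HasMFDerivAt 𝓘(ℝ, ℝ) (𝓡 n) u t (ContinuousLinearMap.toSpanSingleton ℝ w) :=
    hu.hasFDerivAt.hasMFDerivAt
  have h3 := ((h1.hasMFDerivAt.comp t h2).congr_of_eventuallyEq hc).mfderiv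
  have h4 : (mfderiv 𝓘(ℝ, ℝ) (𝓡 n) c t 1 : EuclideanSpace ℝ (Fin n)) =
      mfderiv (𝓡 n) (𝓡 n) (extChartAt (𝓡 n) p).symm (u t) w := by
    have h5 := congrArg (fun (T : ℝ →L[ℝ] EuclideanSpace ℝ (Fin n)) ↦ T 1) h3
    refine h5.trans ?_
    have h6 : (ContinuousLinearMap.toSpanSingleton ℝ w) (1 : ℝ) = w := by simp
    exact congrArg (fun w ↦ (mfderiv (𝓡 n) (𝓡 n) (extChartAt (𝓡 n) p).symm (u t) w :
      EuclideanSpace ℝ (Fin n))) h6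
  rw [sqrt_chartForm_self]
  refine (norm_tangentSpace_congr (n := n) hc.eq_of_nhds _).trans ?_
  exact congrArg (norm (E := TangentSpace (𝓡 n) ((extChartAt (𝓡 n) p).symm (u t)))) h4

/-- A path from `q` to `q'` of length below d ≤ r stays in the ball, where `T` of the coordinate
velocity is at most C times the speed; integrate and let d decrease to the distance. Taking `T` the
identity makes charts Lipschitz; taking `T` a covector of the metric gives the sharp speed bound. -/
lemma norm_chart_sub_le [IsRiemannianManifold (𝓡 n) M] {F : Type*} [NormedAddCommGroup F]
    [NormedSpace ℝ F]
    {p q q' : M} {r : ℝ} {C : ℝ} (hC : 0 ≤ C) (T : EuclideanSpace ℝ (Fin n) →L[ℝ] F)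
    (hsub : Metric.ball q r ⊆ (extChartAt (𝓡 n) p).source)
    (hT : ∀ y ∈ Metric.ball q r, ∀ w, ‖T w‖ ≤ C * √(chartForm p (extChartAt (𝓡 n) p y) w w))
    (h : dist q q' < r) :
    ‖T (extChartAt (𝓡 n) p q' - extChartAt (𝓡 n) p q)‖ ≤ C * dist q q' := by
  have key : ∀ d, dist q q' < d → d ≤ r →
      ‖T (extChartAt (𝓡 n) p q' - extChartAt (𝓡 n) p q)‖ ≤ C * d := by
    intro d hd hdr
    have hd0 : 0 ≤ d := dist_nonneg.trans hd.le
    obtain ⟨c, h0, h1, hc, hcL, -, -⟩ := Manifold.exists_lt_locally_constant_of_riemannianEDist_lt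
      (I := 𝓡 n) (x := q) (y := q') (r := ENNReal.ofReal d) (by
        rwa [← IsRiemannianManifold.out (I := 𝓡 n), edist_dist,
          ENNReal.ofReal_lt_ofReal_iff_of_nonneg dist_nonneg]) zero_lt_one
    have hmem : ∀ t ∈ Icc (0 : ℝ) 1, c t ∈ Metric.ball q r := fun t ht ↦ by
      have h2 : edist (c 0) (c t) < ENNReal.ofReal r :=
        ((edist_le_pathELength (n := n) ht.1 hc.contMDiffOn).trans
          (Manifold.pathELength_mono le_rfl ht.2)).trans_lt
          (hcL.trans_le (ENNReal.ofReal_le_ofReal hdr))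
      rw [h0, edist_dist, ENNReal.ofReal_lt_ofReal_iff_of_nonneg dist_nonneg] at h2
      rwa [Metric.mem_ball']
    have hφ : ∀ t ∈ Icc (0 : ℝ) 1, ContDiffAt ℝ 1 (fun s ↦ extChartAt (𝓡 n) p (c s)) t :=
      fun t ht ↦ contMDiffAt_iff_contDiffAt.1
        (((contMDiffOn_extChartAt (x := p)).contMDiffAt
          ((chartAt _ p).open_source.mem_nhds (by simpa using hsub (hmem t ht)))).comp t
            hc.contMDiffAt)
    have hf : ContDiffOn ℝ 1 (fun s ↦ T (extChartAt (𝓡 n) p (c s))) (Icc 0 1) := fun t ht ↦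
      (T.contDiff.contDiffAt.comp t (hφ t ht)).contDiffWithinAt
    have h3 := enorm_sub_le_lintegral_derivWithin_Icc_of_contDiffOn_Icc hf zero_le_one
    have h4 : ∫⁻ t in Icc (0 : ℝ) 1,
        ‖derivWithin (fun s ↦ T (extChartAt (𝓡 n) p (c s))) (Icc 0 1) t‖ₑ ≤
        ∫⁻ t in Icc (0 : ℝ) 1, ENNReal.ofReal C * ‖mfderiv 𝓘(ℝ, ℝ) (𝓡 n) c t 1‖ₑ := by
      refine setLIntegral_mono' measurableSet_Icc fun t ht ↦ ?_
      have h5 := ((hφ t ht).differentiableAt (by simp)).hasDerivAt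
      have h6 : HasDerivAt (fun s ↦ T (extChartAt (𝓡 n) p (c s)))
          (T (deriv (fun s ↦ extChartAt (𝓡 n) p (c s)) t)) t := T.hasFDerivAt.comp_hasDerivAt t h5
      rw [h6.hasDerivWithinAt.derivWithin (uniqueDiffOn_Icc zero_lt_one t ht)]
      have hs := hsub (hmem t ht)
      have h7 := norm_mfderiv_eq_sqrt_chartForm (p := p) (c := c) h5
        ((extChartAt (𝓡 n) p).map_source hs) (by
          filter_upwards [hc.continuous.continuousAt.preimage_mem_nhds
            ((isOpen_extChartAt_source p).mem_nhds hs)] with s hs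
          exact ((extChartAt (𝓡 n) p).left_inv hs).symm)
      have h8 := hT _ (hmem t ht) (deriv (fun s ↦ extChartAt (𝓡 n) p (c s)) t)
      rw [← h7] at h8
      rw [← ofReal_norm, ← ofReal_norm, ← ENNReal.ofReal_mul hC]
      exact ENNReal.ofReal_le_ofReal h8
    rw [lintegral_const_mul' _ _ ENNReal.ofReal_ne_top,
      ← Manifold.pathELength_eq_lintegral_mfderiv_Icc] at h4
    have h5 := (h3.trans h4).trans (mul_le_mul_right hcL.le _)
    rw [← ENNReal.ofReal_mul hC, h0, h1, ← map_sub, ← ofReal_norm,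
      ENNReal.ofReal_le_ofReal_iff (by positivity)] at h5
    exact h5
  have h1 : Tendsto (fun d ↦ C * d) (𝓝[>] (dist q q')) (𝓝 (C * dist q q')) :=
    (tendsto_id.const_mul C).mono_left nhdsWithin_le_nhds
  refine ge_of_tendsto h1 ?_
  filter_upwards [self_mem_nhdsWithin, nhdsWithin_le_nhds (Iio_mem_nhds h)] with d hd hdr
  exact key d hd (le_of_lt hdr)

/-- The coordinate segment, carried to M, is a curve whose length bounds the distance. -/
lemma dist_chart_symm_le [IsRiemannianManifold (𝓡 n) M] {p : M} {z z' : EuclideanSpace ℝ (Fin n)}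
    {C : ℝ} (hC0 : 0 ≤ C)
    (hz : segment ℝ z z' ⊆ (extChartAt (𝓡 n) p).target)
    (hC : ∀ y ∈ segment ℝ z z', √(chartForm p y (z' - z) (z' - z)) ≤ C) :
    dist ((extChartAt (𝓡 n) p).symm z) ((extChartAt (𝓡 n) p).symm z') ≤ C := by
  set u : ℝ → EuclideanSpace ℝ (Fin n) := fun t ↦ z + t • (z' - z) with hu
  have hmem : ∀ t ∈ Icc (0 : ℝ) 1, u t ∈ segment ℝ z z' := fun t ht ↦ by
    rw [segment_eq_image']
    exact ⟨t, ht, rfl⟩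
  have hus : ContDiff ℝ 1 u := by fun_prop
  have hud : ∀ t, HasDerivAt u (z' - z) t := fun t ↦ by
    have := ((hasDerivAt_id t).smul_const (z' - z)).const_add z
    rwa [one_smul] at this
  have h1 := edist_le_pathELength (n := n) (c := fun t ↦ (extChartAt (𝓡 n) p).symm (u t))
    zero_le_one ((contMDiffOn_extChartAt_symm p).comp hus.contMDiff.contMDiffOn
      fun t ht ↦ hz (hmem t ht))
  rw [Manifold.pathELength_eq_lintegral_mfderiv_Icc] at h1
  have h2 : ∫⁻ t in Icc (0 : ℝ) 1, ‖mfderiv 𝓘(ℝ, ℝ) (𝓡 n)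
      (fun t ↦ (extChartAt (𝓡 n) p).symm (u t)) t 1‖ₑ ≤
      ∫⁻ t in Icc (0 : ℝ) 1, ENNReal.ofReal C := by
    refine setLIntegral_mono' measurableSet_Icc fun t ht ↦ ?_
    rw [← ofReal_norm, norm_mfderiv_eq_sqrt_chartForm (hud t) (hz (hmem t ht)) .rfl]
    exact ENNReal.ofReal_le_ofReal (hC _ (hmem t ht))
  have h3 := h1.trans h2
  simp only [hu, zero_smul, add_zero, one_smul, add_sub_cancel, lintegral_const,
    Measure.restrict_apply MeasurableSet.univ, univ_inter, Real.volume_Icc, sub_zero,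
    ENNReal.ofReal_one, mul_one, edist_dist] at h3
  exact (ENNReal.ofReal_le_ofReal_iff hC0).1 h3

variable [IsContMDiffRiemannianBundle (𝓡 n) ∞ (EuclideanSpace ℝ (Fin n))
      (fun q : M ↦ TangentSpace (𝓡 n) q)]

lemma continuousAt_sqrt_chartForm {p : M} {z : EuclideanSpace ℝ (Fin n)}
    (hz : z ∈ (extChartAt (𝓡 n) p).target) (w : EuclideanSpace ℝ (Fin n)) :
    ContinuousAt (fun x : EuclideanSpace ℝ (Fin n) × EuclideanSpace ℝ (Fin n) ↦
      √(chartForm p x.1 x.2 x.2)) (z, w) := by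
  have h1 : ContinuousAt (chartForm (n := n) p) z :=
    (contDiffOn_chartForm p).continuousOn.continuousAt
      ((isOpen_extChartAt_target p).mem_nhds hz)
  have h2 : ContinuousAt (fun x : EuclideanSpace ℝ (Fin n) × EuclideanSpace ℝ (Fin n) ↦
      chartForm p x.1) (z, w) := ContinuousAt.comp (f := Prod.fst) (x := (z, w)) h1 continuousAt_fst
  exact ((h2.clm_apply continuousAt_snd).clm_apply continuousAt_snd).sqrt

/-- A strict inequality on the compact unit sphere persists for nearby base points, and homogeneity
extends it to all vectors. -/
lemma eventually_norm_le_sqrt_chartForm {F : Type*} [NormedAddCommGroup F] [NormedSpace ℝ F]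
    {p : M} {z : EuclideanSpace ℝ (Fin n)} (hz : z ∈ (extChartAt (𝓡 n) p).target)
    (T : EuclideanSpace ℝ (Fin n) →L[ℝ] F) {C : ℝ}
    (hT : ∀ w ≠ 0, ‖T w‖ < C * √(chartForm p z w w)) :
    ∀ᶠ y in 𝓝 z, ∀ w, ‖T w‖ ≤ C * √(chartForm p y w w) := by
  have h1 : ∀ᶠ y in 𝓝 z, ∀ w ∈ Metric.sphere (0 : EuclideanSpace ℝ (Fin n)) 1,
      ‖T w‖ ≤ C * √(chartForm p y w w) := by
    refine (isCompact_sphere _ _).eventually_forall_of_forall_eventually fun w hw ↦ ?_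
    have hw0 : w ≠ 0 := by rintro rfl; simp at hw
    have h2 : ContinuousAt (fun x : EuclideanSpace ℝ (Fin n) × EuclideanSpace ℝ (Fin n) ↦
        ‖T x.2‖) (z, w) := by fun_prop
    have h3 := (continuousAt_sqrt_chartForm hz w).const_mul C
    exact (h2.eventually_lt h3 (hT w hw0)).mono fun _ h ↦ h.le
  filter_upwards [h1] with y hy w
  rcases eq_or_ne w 0 with rfl | hw
  · simp
  have hw' : 0 < ‖w‖ := norm_pos_iff.2 hw
  have h2 := hy (‖w‖⁻¹ • w) (by simp [norm_smul, hw'.ne'])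
  have h3 : chartForm p y (‖w‖⁻¹ • w) (‖w‖⁻¹ • w) = (‖w‖⁻¹) ^ 2 * chartForm p y w w := by
    simp only [map_smul, smul_apply, smul_eq_mul]
    ring
  rw [h3, Real.sqrt_mul (sq_nonneg _), Real.sqrt_sq (by positivity), map_smul, norm_smul,
    norm_inv, norm_norm, mul_left_comm] at h2
  exact le_of_mul_le_mul_left h2 (by positivity)

lemma exists_eventually_norm_le_sqrt_chartForm {p : M} {z : EuclideanSpace ℝ (Fin n)}
    (hz : z ∈ (extChartAt (𝓡 n) p).target) :
    ∃ C > 0, ∀ᶠ y in 𝓝 z, ∀ w, ‖w‖ ≤ C * √(chartForm p y w w) := by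
  obtain ⟨m, hm, h⟩ := (isCompact_sphere (0 : EuclideanSpace ℝ (Fin n)) 1).exists_forall_le'
    (f := fun w ↦ √(chartForm p z w w)) (a := 0) (by
      refine fun w _ ↦ ContinuousAt.continuousWithinAt ?_
      exact (continuousAt_sqrt_chartForm hz w).comp (f := fun w ↦ (z, w)) (by fun_prop))
    (fun w hw ↦ by
      have hw0 : w ≠ 0 := by rintro rfl; simp at hw
      exact Real.sqrt_pos.2 (chartForm_self_pos hz hw0))
  -- 1/m would do at `z` itself; doubling it gives the strict inequality that survives moving the
  -- base point.
  refine ⟨2 / m, by positivity, ?_⟩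
  refine eventually_norm_le_sqrt_chartForm hz (.id ℝ _) fun w hw ↦ ?_
  have hw' : 0 < ‖w‖ := norm_pos_iff.2 hw
  have h2 := h (‖w‖⁻¹ • w) (by simp [norm_smul, hw'.ne'])
  have h3 : chartForm p z (‖w‖⁻¹ • w) (‖w‖⁻¹ • w) = (‖w‖⁻¹) ^ 2 * chartForm p z w w := by
    simp only [map_smul, smul_apply, smul_eq_mul]
    ring
  rw [h3, Real.sqrt_mul (sq_nonneg _), Real.sqrt_sq (by positivity)] at h2
  have h4 : m * ‖w‖ ≤ √(chartForm p z w w) := by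
    rw [inv_mul_eq_div, le_div_iff₀ hw'] at h2
    exact h2
  rw [ContinuousLinearMap.id_apply, div_mul_eq_mul_div, lt_div_iff₀ hm]
  nlinarith

variable [IsRiemannianManifold (𝓡 n) M]

/-- Charts are locally Lipschitz. -/
lemma exists_lipschitzOnWith_chart (p : M) :
    ∃ (C : ℝ≥0), ∃ r > 0, Metric.ball p r ⊆ (extChartAt (𝓡 n) p).source ∧
      LipschitzOnWith C (extChartAt (𝓡 n) p) (Metric.ball p r) := by
  obtain ⟨C, hC, h⟩ := exists_eventually_norm_le_sqrt_chartForm (mem_extChartAt_target (I := 𝓡 n) p)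
  obtain ⟨r, hr, hsub⟩ := Metric.mem_nhds_iff.1
    (inter_mem (extChartAt_source_mem_nhds (I := 𝓡 n) p) ((continuousAt_extChartAt p) h))
  -- Two points of the ball of radius r/3 are less than 2r/3 apart, and the ball of radius 2r/3
  -- about either of them stays inside that of radius r.
  refine ⟨C.toNNReal, r / 3, by positivity,
    (Metric.ball_subset_ball (by linarith)).trans fun y hy ↦ (hsub hy).1,
    LipschitzOnWith.of_dist_le_mul fun y hy y' hy' ↦ ?_⟩
  have h1 : dist y y' < 2 * r / 3 := by
    have := dist_triangle_right y y' p
    rw [Metric.mem_ball] at hy hy'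
    linarith
  have h2 : Metric.ball y (2 * r / 3) ⊆ Metric.ball p r := by
    refine Metric.ball_subset_ball' ?_
    rw [Metric.mem_ball] at hy
    linarith
  have := norm_chart_sub_le hC.le (.id ℝ _) (fun z hz ↦ (hsub (h2 hz)).1)
    (fun z hz w ↦ (hsub (h2 hz)).2 w) h1
  rw [dist_eq_norm', Real.coe_toNNReal C hC.le]
  exact this

/-- The speed of a Lipschitz curve is at most its Lipschitz constant. -/
lemma sqrt_chartForm_le_of_eventually_dist_le {p : M} {c : ℝ → M} {t ℓ : ℝ} (hℓ : 0 ≤ ℓ)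
    (hc : ∀ᶠ s in 𝓝 t, dist (c t) (c s) ≤ ℓ * |s - t|)
    (hs : c t ∈ (extChartAt (𝓡 n) p).source) {w : EuclideanSpace ℝ (Fin n)}
    (hw : HasDerivAt (fun s ↦ extChartAt (𝓡 n) p (c s)) w t) :
    √(chartForm p (extChartAt (𝓡 n) p (c t)) w w) ≤ ℓ := by
  set z := extChartAt (𝓡 n) p (c t)
  have hz : z ∈ (extChartAt (𝓡 n) p).target := (extChartAt (𝓡 n) p).map_source hs
  rcases eq_or_ne w 0 with rfl | hw0
  · simpa using hℓ
  set a := √(chartForm p z w w) with ha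
  have ha0 : 0 < a := Real.sqrt_pos.2 (chartForm_self_pos hz hw0)
  have haa : a * a = chartForm p z w w := Real.mul_self_sqrt (chartForm_self_pos hz hw0).le
  -- Test the velocity with the covector G_z(w, ·), whose norm for the metric is a. For C > a it is
  -- bounded by C times the metric norm near z, so its derivative a² along the curve is at most Cℓ;
  -- letting C decrease to a gives a ≤ ℓ.
  have key : ∀ C, a < C → a * a ≤ C * ℓ := by
    intro C haC
    have hC : 0 < C := ha0.trans haC
    have h1 := eventually_norm_le_sqrt_chartForm hz (chartForm p z w) (C := C) fun v hv ↦
      (abs_chartForm_le p z w v).trans_lt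
        (mul_lt_mul_of_pos_right haC (Real.sqrt_pos.2 (chartForm_self_pos hz hv)))
    obtain ⟨r, hr, hsub⟩ := Metric.mem_nhds_iff.1
      (inter_mem (extChartAt_source_mem_nhds' (I := 𝓡 n) hs) ((continuousAt_extChartAt' hs) h1))
    have h2 : HasDerivAt (fun s ↦ chartForm p z w (extChartAt (𝓡 n) p (c s)))
      (chartForm p z w w) t := (chartForm p z w).hasFDerivAt.comp_hasDerivAt t hw
    have h3 : Tendsto (fun s ↦ ℓ * |s - t|) (𝓝 t) (𝓝 0) := by
      have : Continuous fun s ↦ ℓ * |s - t| := by fun_prop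
      simpa using this.tendsto t
    have h4 := h2.hasFDerivAt.le_of_lip' (C := C * ℓ) (by positivity) (by
      filter_upwards [hc, h3.eventually (Iio_mem_nhds hr)] with s hs hsr
      rw [← map_sub]
      refine (norm_chart_sub_le hC.le (chartForm p z w) (fun y hy ↦ (hsub hy).1)
        (fun y hy v ↦ (hsub hy).2 v) (hs.trans_lt hsr)).trans ?_
      rw [mul_assoc, Real.norm_eq_abs]
      gcongr)
    rw [ContinuousLinearMap.norm_toSpanSingleton, Real.norm_eq_abs, ← haa, abs_mul_self] at h4
    exact h4
  have h1 : Tendsto (fun C ↦ C * ℓ) (𝓝[>] a) (𝓝 (a * ℓ)) :=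
    (tendsto_id.mul_const ℓ).mono_left nhdsWithin_le_nhds
  have h2 : a * a ≤ a * ℓ :=
    ge_of_tendsto h1 (by filter_upwards [self_mem_nhdsWithin] with C hC using key C hC)
  exact le_of_mul_le_mul_left h2 ha0

/-- The distance between two points on the image of a Lipschitz curve under an inverse chart is at
most the length of the curve, measured in the chart. -/
lemma edist_chart_symm_le_lintegral {p : M} {x₀ : EuclideanSpace ℝ (Fin n)} {R : ℝ}
    (hR : Metric.ball x₀ R ⊆ (extChartAt (𝓡 n) p).target)
    {v : ℝ → EuclideanSpace ℝ (Fin n)} {K : ℝ≥0} (hv : LipschitzWith K v)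
    (hvR : ∀ t, v t ∈ Metric.ball x₀ R) {s t : ℝ} (hst : s ≤ t) :
    edist ((extChartAt (𝓡 n) p).symm (v s)) ((extChartAt (𝓡 n) p).symm (v t)) ≤
      ∫⁻ τ in Icc s t, ENNReal.ofReal √(chartForm p (v τ) (deriv v τ) (deriv v τ)) := by
  set Φ := (extChartAt (𝓡 n) p).symm
  -- It suffices to bound the derivative of this scalar function by the speed almost everywhere, as
  -- `F` is Lipschitz and so the integral of its derivative.
  set F : ℝ → ℝ := fun τ ↦ dist (Φ (v s)) (Φ (v τ))
  have hFle : ∀ τ τ', |F τ' - F τ| ≤ dist (Φ (v τ)) (Φ (v τ')) := fun τ τ' ↦ by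
    rw [dist_comm (Φ (v τ))]
    have := abs_dist_sub_le (Φ (v τ')) (Φ (v τ)) (Φ (v s))
    rwa [dist_comm _ (Φ (v s)), dist_comm _ (Φ (v s))] at this
  have hseg : ∀ τ τ', segment ℝ (v τ) (v τ') ⊆ (extChartAt (𝓡 n) p).target := fun τ τ' ↦
    ((convex_ball x₀ R).segment_subset (hvR τ) (hvR τ')).trans hR
  have hG := (contDiffOn_chartForm (n := n) p).continuousOn
  -- the function `F` is Lipschitz
  obtain ⟨K', hF⟩ : ∃ K', LipschitzOnWith K' F (uIcc s t) := by
    obtain ⟨R', hR', hsub⟩ := exists_lt_subset_ball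
      ((isCompact_uIcc (a := s) (b := t)).image hv.continuous).isClosed
      (image_subset_iff.2 fun τ _ ↦ hvR τ)
    obtain ⟨C, hC⟩ := (isCompact_closedBall x₀ R').exists_bound_of_continuousOn
      (hG.mono ((Metric.closedBall_subset_ball hR').trans hR))
    refine ⟨Real.toNNReal √C.toNNReal * K, LipschitzOnWith.of_dist_le_mul fun τ hτ τ' hτ' ↦ ?_⟩
    rw [dist_comm, Real.dist_eq]
    refine (hFle _ _).trans ?_
    have h1 : dist (v τ') (v τ) ≤ K * dist τ τ' := by rw [dist_comm τ]; exact hv.dist_le_mul _ _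
    have h2 : dist (Φ (v τ)) (Φ (v τ')) ≤ √C.toNNReal * ‖v τ' - v τ‖ := by
      refine dist_chart_symm_le (by positivity) (hseg _ _) fun y hy ↦ ?_
      have hy' : y ∈ Metric.closedBall x₀ R' := Metric.ball_subset_closedBall
        ((convex_ball x₀ R').segment_subset (hsub (mem_image_of_mem v hτ))
          (hsub (mem_image_of_mem v hτ')) hy)
      rw [Real.sqrt_le_left (by positivity), mul_pow, Real.sq_sqrt (by positivity)]
      refine (le_abs_self _).trans (((chartForm p y).le_opNorm₂ _ _).trans ?_)
      rw [mul_assoc, sq]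
      gcongr
      exact (hC y hy').trans (Real.le_coe_toNNReal C)
    refine h2.trans ?_
    rw [NNReal.coe_mul, Real.coe_toNNReal _ (Real.sqrt_nonneg _), mul_assoc, ← dist_eq_norm]
    gcongr
  have hAC := hF.absolutelyContinuousOnInterval
  have h1 := hAC.integral_deriv_eq_sub
  have h2 : edist (Φ (v s)) (Φ (v t)) = ‖∫ τ in s..t, deriv F τ‖ₑ := by
    rw [h1, edist_dist, ← ofReal_norm]
    simp [F]
  rw [h2, intervalIntegral.integral_of_le hst]
  refine (enorm_integral_le_lintegral_enorm _).trans ?_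
  rw [← setLIntegral_congr Ioc_ae_eq_Icc]
  refine setLIntegral_mono_ae' measurableSet_Ioc ?_
  filter_upwards [hAC.ae_differentiableAt, hv.ae_differentiableAt_real] with τ hFτ hvτ hτ
  replace hFτ := (hFτ (by rw [uIcc_of_le hst]; exact Ioc_subset_Icc_self hτ)).hasDerivAt
  replace hvτ := hvτ.hasDerivAt
  rw [← ofReal_norm]
  refine ENNReal.ofReal_le_ofReal ?_
  set w := deriv v τ
  -- If C exceeds the speed at τ, joint continuity in point and direction keeps it above the norm of
  -- the difference quotient along the whole chord to a nearby time, and `dist_chart_symm_le`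
  -- applies to that chord.
  refine le_of_forall_gt_imp_ge_of_dense fun C hC ↦ ?_
  have hC0 : 0 ≤ C := (Real.sqrt_nonneg _).trans hC.le
  have hzτ := hR (hvR τ)
  obtain ⟨ε, hε, hεC⟩ := Metric.eventually_nhds_iff_ball.1
    ((continuousAt_sqrt_chartForm hzτ w).eventually_lt continuousAt_const hC)
  have h3 := hFτ.hasFDerivAt.le_of_lip' hC0 (by
    have h4 : ∀ᶠ τ' in 𝓝 τ, v τ' ∈ Metric.ball (v τ) ε :=
      hv.continuous.continuousAt.eventually (Metric.ball_mem_nhds _ hε)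
    have h5 : ∀ᶠ τ' in 𝓝 τ, τ' ≠ τ → slope v τ τ' ∈ Metric.ball w ε :=
      eventually_nhdsWithin_iff.1
        ((hasDerivAt_iff_tendsto_slope.1 hvτ).eventually (Metric.ball_mem_nhds _ hε))
    filter_upwards [h4, h5] with τ' h4 h5
    refine (hFle _ _).trans (dist_chart_symm_le (by positivity) (hseg _ _) fun y hy ↦ ?_)
    rcases eq_or_ne τ' τ with rfl | hne
    · simp
    have h6 := (convex_ball (v τ) ε).segment_subset (Metric.mem_ball_self hε) h4 hy
    have h7 := hεC (y, slope v τ τ') (by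
      rw [← ball_prod_same]
      exact ⟨h6, h5 hne⟩)
    have h8 : v τ' - v τ = (τ' - τ) • slope v τ τ' := by
      rw [slope_def_module, smul_smul, mul_inv_cancel₀ (sub_ne_zero.2 hne), one_smul]
    have h9 : chartForm p y (v τ' - v τ) (v τ' - v τ) =
        (τ' - τ) ^ 2 * chartForm p y (slope v τ τ') (slope v τ τ') := by
      rw [h8]
      simp only [map_smul, smul_apply, smul_eq_mul]
      ring
    rw [h9, Real.sqrt_mul (sq_nonneg _), Real.sqrt_sq_eq_abs, mul_comm, Real.norm_eq_abs]
    exact mul_le_mul_of_nonneg_right h7.le (abs_nonneg _))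
  rwa [ContinuousLinearMap.norm_toSpanSingleton] at h3

end ChartDistance

end RiemannianGeodesic

end

noncomputable section

namespace RiemannianGeodesic

open Set Filter Topology MeasureTheory
open scoped NNReal ENNReal

/-! ### Arcs of minimizing paths -/

section Subpath

variable {X : Type*} [MetricSpace X] {x y : X}

/-- Subpaths of minimizing paths are minimizing. -/
lemma mul_sub_le_of_lengthLE_subpath {γ : Path x y} {ℓ : ℝ≥0} (hγ : LipschitzWith ℓ γ)
    (hmin : ∀ L, LengthLE (.mk γ) L → ℓ ≤ L) {s t : unitInterval} {L : ℝ≥0}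
    (h : LengthLE (.mk (γ.subpath s t)) L) : ℓ * (t - s : ℝ) ≤ L := by
  -- The outer arcs cost at most ℓs and ℓ(1 - t), so the middle arc must account for the rest of ℓ.
  have h0 : LengthLE (.mk (γ.subpath 0 s)) (ℓ * Real.toNNReal s) :=
    .subpath hγ s.2.1 (by simp [unitInterval.nonneg s])
  have h1 : LengthLE (.mk (γ.subpath t 1)) (ℓ * Real.toNNReal (1 - t)) :=
    .subpath hγ t.2.2 (by simp [unitInterval.le_one t])
  have h2 := (h0.trans h).trans h1
  rw [mk_subpath_trans, mk_subpath_trans, Path.subpath_zero_one] at h2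
  have h3 := hmin _ (quotient_of_cast (Q := fun _ _ A ↦ LengthLE A _) γ.source γ.target h2)
  have h4 : (ℓ : ℝ) ≤ ℓ * s + L + ℓ * (1 - t) := by
    have := NNReal.coe_le_coe.2 h3
    rwa [NNReal.coe_add, NNReal.coe_add, NNReal.coe_mul, NNReal.coe_mul,
      Real.coe_toNNReal _ (unitInterval.nonneg s),
      Real.coe_toNNReal _ (sub_nonneg.2 (unitInterval.le_one t))] at this
  linarith

lemma lipschitzWith_extend {γ : Path x y} {ℓ : ℝ≥0} (hγ : LipschitzWith ℓ γ) :
    LipschitzWith ℓ γ.extend := by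
  have := hγ.comp (LipschitzWith.projIcc zero_le_one)
  rwa [mul_one] at this

end Subpath

/-! ### Minimizing paths are geodesics of least length -/

section Minimizer

set_option maxSynthPendingDepth 3

variable {n : ℕ} {M : Type*} [MetricSpace M]
    [ChartedSpace (EuclideanSpace ℝ (Fin n)) M] [IsManifold (𝓡 n) ∞ M]
    [RiemannianBundle (fun q : M ↦ TangentSpace (𝓡 n) q)]
    [IsContMDiffRiemannianBundle (𝓡 n) ∞ (EuclideanSpace ℝ (Fin n))
      (fun q : M ↦ TangentSpace (𝓡 n) q)]

lemma fderiv_chartMetric {p : M} {z : EuclideanSpace ℝ (Fin n)}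
    (hz : z ∈ (extChartAt (𝓡 n) p).target) (d v w : EuclideanSpace ℝ (Fin n)) :
    fderiv ℝ (fun z' ↦ chartMetric p z' v w) z d = fderiv ℝ (chartForm p) z d v w := by
  have h1 : HasFDerivAt (chartForm (n := n) p) (fderiv ℝ (chartForm p) z) z :=
    (((contDiffOn_chartForm p).contDiffAt
      ((isOpen_extChartAt_target p).mem_nhds hz)).differentiableAt (by simp)).hasFDerivAt
  have h2 := ((h1.clm_apply (hasFDerivAt_const v z)).clm_apply (hasFDerivAt_const w z)).fderiv
  refine (congrArg (fun T : EuclideanSpace ℝ (Fin n) →L[ℝ] ℝ ↦ T d) h2).trans ?_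
  simp

variable [IsRiemannianManifold (𝓡 n) M] {x y : M}

/-- Replacing an arc of a minimizing path, contained in a chart ball, by another curve does not
decrease the length. -/
lemma mul_sub_le_integral_of_eq_outside {γ : Path x y} {ℓ : ℝ≥0} (hγ : LipschitzWith ℓ γ)
    (hmin : ∀ L, LengthLE (.mk γ) L → ℓ ≤ L) {p : M} {R : ℝ}
    (hR : Metric.ball (extChartAt (𝓡 n) p p) R ⊆ (extChartAt (𝓡 n) p).target)
    {a b : unitInterval} (hab : a ≤ b)
    (hγR : ∀ t ∈ Icc a b, γ t ∈ (extChartAt (𝓡 n) p).source ∩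
      extChartAt (𝓡 n) p ⁻¹' Metric.ball (extChartAt (𝓡 n) p p) R)
    {v : ℝ → EuclideanSpace ℝ (Fin n)} {K : ℝ≥0} (hv : LipschitzWith K v)
    (hvR : ∀ t, v t ∈ Metric.ball (extChartAt (𝓡 n) p p) R)
    (hva : v a = extChartAt (𝓡 n) p (γ a)) (hvb : v b = extChartAt (𝓡 n) p (γ b)) :
    ℓ * (b - a : ℝ) ≤ ∫ t in (a : ℝ)..b, √(chartForm p (v t) (deriv v t) (deriv v t)) := by
  set φ := extChartAt (𝓡 n) p
  have hab' : (a : ℝ) ≤ b := hab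
  let η : Path (γ a) (γ b) :=
    ⟨⟨fun τ ↦ φ.symm (v (a + (b - a) * τ)),
      (continuousOn_extChartAt_symm p).comp_continuous (hv.continuous.comp (by fun_prop))
        fun τ ↦ hR (hvR _)⟩,
      by simpa [hva] using φ.left_inv (hγR a ⟨le_rfl, hab⟩).1,
      by simpa [hvb] using φ.left_inv (hγR b ⟨hab, le_rfl⟩).1⟩
  -- Both arcs lie in one chart ball, so the replacement does not leave the homotopy class.
  have hη : η.Homotopic (γ.subpath a b) := by
    refine homotopic_of_mem_chart hR (fun τ ↦ ⟨φ.map_target (hR (hvR (a + (b - a) * τ))), ?_⟩)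
      fun τ ↦ ?_
    · change φ (φ.symm (v (a + (b - a) * τ))) ∈ Metric.ball (φ p) R
      rw [φ.right_inv (hR (hvR _))]
      exact hvR _
    · have : γ.subpath a b τ ∈ range (γ.subpath a b) := mem_range_self τ
      rw [Path.range_subpath_of_le _ _ _ hab] at this
      obtain ⟨s, hs, hsτ⟩ := this
      rw [← hsτ]
      exact hγR s hs
  have hi := (intervalIntegrable_form (a := a) (b := b)
    ((contDiffOn_chartForm (n := n) p).continuousOn.mono hR)
    (fun z hz w ↦ by
      rcases eq_or_ne w 0 with rfl | hw
      · simp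
      · exact (chartForm_self_pos (hR hz) hw).le) hv hvR).2
  have h1 : LengthLE (.mk η)
      (∫ t in (a : ℝ)..b, √(chartForm p (v t) (deriv v t) (deriv v t))).toNNReal := by
    refine LengthLE.of_lintegral
      (f := fun t ↦ ENNReal.ofReal √(chartForm p (v t) (deriv v t) (deriv v t)))
      (c := fun t ↦ φ.symm (v t)) hab' ?_ (fun τ ↦ rfl) fun s t _ hst _ ↦
        edist_chart_symm_le_lintegral hR hv hvR hst
    rw [intervalIntegral.integral_of_le hab', ← integral_Icc_eq_integral_Ioc]
    refine (ofReal_integral_eq_lintegral_ofReal ?_ (Eventually.of_forall fun t ↦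
      Real.sqrt_nonneg _)).symm.le
    exact (intervalIntegrable_iff_integrableOn_Icc_of_le hab').1 hi
  rw [Path.Homotopic.Quotient.eq.2 hη] at h1
  refine (mul_sub_le_of_lengthLE_subpath hγ hmin h1).trans_eq (Real.coe_toNNReal _ ?_)
  exact intervalIntegral.integral_nonneg hab' fun t _ ↦ Real.sqrt_nonneg _

/-- A minimizing path parametrized with constant speed is, in charts, smooth and satisfies the
geodesic equation. -/
lemma exists_contDiffOn_and_geodesic {γ : Path x y} {ℓ : ℝ≥0} (hγ : LipschitzWith ℓ γ)
    (hmin : ∀ L, LengthLE (.mk γ) L → ℓ ≤ L) {t₀ : ℝ} (ht₀ : t₀ ∈ Icc (0 : ℝ) 1) {p : M}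
    (hp : p = γ.extend t₀) {u : ℝ → EuclideanSpace ℝ (Fin n)}
    (hu : u = fun s ↦ extChartAt (𝓡 n) p (γ.extend s)) :
    ∃ a b, Icc a b ∈ 𝓝[Icc 0 1] t₀ ∧ t₀ ∈ Icc a b ∧ (t₀ ∈ Ioo (0 : ℝ) 1 → t₀ ∈ Ioo a b) ∧
      (∀ s ∈ Icc a b, γ.extend s ∈ (extChartAt (𝓡 n) p).source) ∧ ContDiffOn ℝ ∞ u (Icc a b) ∧
      ∀ t ∈ Ioo a b, ∀ w, chartForm p (u t) (deriv (deriv u) t) w +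
        fderiv ℝ (chartForm p) (u t) (deriv u t) (deriv u t) w -
        fderiv ℝ (chartForm p) (u t) w (deriv u t) (deriv u t) / 2 = 0 := by
  set φ := extChartAt (𝓡 n) p
  obtain ⟨R, hR0, hR⟩ := exists_ball_subset_target (n := n) p
  obtain ⟨C, r, hr, -, hC⟩ := exists_lipschitzOnWith_chart (n := n) p
  have hγe := lipschitzWith_extend hγ
  have hN : (φ.source ∩ φ ⁻¹' Metric.ball (φ p) R) ∩ Metric.ball p r ∈ 𝓝 (γ.extend t₀) := by
    rw [← hp]
    exact inter_mem (chart_preimage_ball_mem_nhds p hR0) (Metric.ball_mem_nhds p hr)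
  obtain ⟨δ, hδ, hδγ⟩ := Metric.mem_nhds_iff.1 (hγe.continuous.continuousAt.preimage_mem_nhds hN)
  -- Clipping to the unit interval lets `t₀` be an endpoint, as smoothness is required on the closed
  -- interval.
  set a := max 0 (t₀ - δ / 2) with ha
  set b := min 1 (t₀ + δ / 2) with hb
  have hat : a ≤ t₀ := max_le ht₀.1 (by linarith)
  have htb : t₀ ≤ b := le_min ht₀.2 (by linarith)
  have hab : a < b := max_lt (lt_min one_pos (by linarith [ht₀.1]))
    (lt_min (by linarith [ht₀.2]) (by linarith))
  have ha0 : 0 ≤ a := le_max_left _ _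
  have hb1 : b ≤ 1 := min_le_left _ _
  have hmem : ∀ s ∈ Icc a b, γ.extend s ∈ (φ.source ∩ φ ⁻¹' Metric.ball (φ p) R) ∩
      Metric.ball p r := fun s hs ↦ by
    refine hδγ ?_
    have h1 := (le_max_right _ _).trans hs.1
    have h2 := hs.2.trans (min_le_right _ _)
    rw [Metric.mem_ball, Real.dist_eq, abs_lt]
    constructor <;> linarith
  -- Freezing the curve outside [a, b] makes it globally Lipschitz with compact range in the chart
  -- ball, as the variational lemmas require.
  set u' : ℝ → EuclideanSpace ℝ (Fin n) := fun s ↦ φ (γ.extend (projIcc a b hab.le s)) with hu'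
  have hEq : EqOn u' u (Icc a b) := fun s hs ↦ by
    simp only [hu', hu, projIcc_of_mem hab.le hs]
  have hu'L : LipschitzWith (C * ℓ) u' := LipschitzWith.of_dist_le_mul fun s t ↦ by
    refine (hC.dist_le_mul _ (hmem _ (projIcc a b hab.le s).2).2 _
      (hmem _ (projIcc a b hab.le t).2).2).trans ?_
    rw [NNReal.coe_mul, mul_assoc]
    gcongr
    refine (hγe.dist_le_mul _ _).trans ?_
    gcongr
    simpa [Subtype.dist_eq] using (LipschitzWith.projIcc hab.le).dist_le_mul s t
  have hu'R : ∀ t, u' t ∈ Metric.ball (φ p) R := fun t ↦ (hmem _ (projIcc a b hab.le t).2).1.2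
  have hu'c : IsCompact (range u') := by
    have h1 : range u' = u' '' Icc a b := by
      refine Subset.antisymm ?_ (image_subset_range _ _)
      rintro _ ⟨t, rfl⟩
      exact ⟨projIcc a b hab.le t, (projIcc a b hab.le t).2, by simp [hu']⟩
    rw [h1]
    exact isCompact_Icc.image hu'L.continuous
  have hG : ContDiffOn ℝ ∞ (chartForm (n := n) p) (Metric.ball (φ p) R) :=
    (contDiffOn_chartForm p).mono hR
  have hpos : ∀ z ∈ Metric.ball (φ p) R, ∀ w, w ≠ 0 → 0 < chartForm p z w w := fun z hz w hw ↦
    chartForm_self_pos (hR hz) hw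
  have hpos' : ∀ z ∈ Metric.ball (φ p) R, ∀ w, 0 ≤ chartForm p z w w := fun z hz w ↦ by
    rcases eq_or_ne w 0 with rfl | hw
    · simp
    · exact (hpos z hz w hw).le
  have hev : ∀ t ∈ Ioo a b, u' =ᶠ[𝓝 t] u := fun t ht ↦ by
    filter_upwards [Ioo_mem_nhds ht.1 ht.2] with s hs using hEq (Ioo_subset_Icc_self hs)
  have hspeed : ∀ᵐ t, t ∈ Ioc a b → chartForm p (u' t) (deriv u' t) (deriv u' t) ≤
      (ℓ : ℝ) ^ 2 := by
    filter_upwards [hu'L.ae_differentiableAt_real, Measure.ae_ne volume b] with t htd htb ht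
    have ht' : t ∈ Ioo a b := ⟨ht.1, ht.2.lt_of_ne htb⟩
    have h1 : HasDerivAt u (deriv u' t) t := htd.hasDerivAt.congr_of_eventuallyEq (hev t ht').symm
    rw [hu] at h1
    have h2 := sqrt_chartForm_le_of_eventually_dist_le ℓ.2 (Eventually.of_forall fun s ↦ by
      rw [dist_comm]; exact hγe.dist_le_mul s t) (hmem t (Ioo_subset_Icc_self ht')).1.1 h1
    rw [hEq (Ioo_subset_Icc_self ht'), hu]
    exact (Real.sqrt_le_left ℓ.2).1 h2
  have heq := exists_ae_momentum_eq hab Metric.isOpen_ball hG (chartForm_symm p) hpos' hu'L hu'R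
    hu'c ℓ.2 hspeed (fun v K' hv hvu hvR ↦ by
      have hproj : ∀ s (hs : s ∈ Icc a b) (hs' : s ∈ unitInterval), u' s = φ (γ ⟨s, hs'⟩) := by
        intro s hs hs'
        rw [hEq hs, hu]
        simp only
        rw [Path.extend_apply _ hs']
      exact mul_sub_le_integral_of_eq_outside (a := ⟨a, ha0, hab.le.trans hb1⟩)
        (b := ⟨b, ha0.trans hab.le, hb1⟩) hγ hmin hR hab.le
        (fun t ht ↦ by
          rw [← Path.extend_extends' γ t]
          exact (hmem t ht).1) hv hvR
        ((hvu a fun h ↦ lt_irrefl _ h.1).trans (hproj a ⟨le_rfl, hab.le⟩ _))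
        ((hvu b fun h ↦ lt_irrefl _ h.2).trans (hproj b ⟨hab.le, le_rfl⟩ _)))
  obtain ⟨hsmooth, hgeo⟩ := contDiffOn_and_geodesic_of_ae_momentum_eq hab Metric.isOpen_ball hG hpos
    hu'L hu'R hu'c heq
  refine ⟨a, b, ?_, ⟨hat, htb⟩, fun h ↦ ⟨max_lt h.1 (by linarith), lt_min h.2 (by linarith)⟩,
    fun s hs ↦ (hmem s hs).1.1, hsmooth.congr fun s hs ↦ (hEq hs).symm, fun t ht w ↦ ?_⟩
  · rw [ha, hb, ← Icc_inter_Icc]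
    exact inter_mem self_mem_nhdsWithin
      (nhdsWithin_le_nhds (Icc_mem_nhds (by linarith) (by linarith)))
  · have h1 := hgeo t ht w
    rwa [(hev t ht).deriv.deriv_eq, (hev t ht).deriv_eq, (hev t ht).eq_of_nhds] at h1

/-- With both velocity slots equal, the first two terms of the Christoffel symbol coincide, and the
symbol becomes the expression of the Euler-Lagrange equation. -/
lemma isGeodesic_of_minimal {γ : Path x y} {ℓ : ℝ≥0} (hγ : LipschitzWith ℓ γ)
    (hmin : ∀ L, LengthLE (.mk γ) L → ℓ ≤ L) : IsGeodesic (n := n) γ := by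
  refine ⟨fun t ht ↦ ?_, fun t ht w ↦ ?_⟩
  · obtain ⟨a, b, hab, htab, -, hs, hsm, -⟩ :=
      exists_contDiffOn_and_geodesic (n := n) hγ hmin ht rfl rfl
    have h1 : ContMDiffOn 𝓘(ℝ, ℝ) (𝓡 n) ∞ γ.extend (Icc a b) :=
      ((contMDiffOn_extChartAt_symm (γ.extend t)).comp hsm.contMDiffOn
        fun s hs' ↦ (extChartAt (𝓡 n) (γ.extend t)).map_source (hs s hs')).congr fun s hs' ↦
          ((extChartAt (𝓡 n) (γ.extend t)).left_inv (hs s hs')).symm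
    exact (h1 t htab).mono_of_mem_nhdsWithin hab
  · intro u
    obtain ⟨a, b, -, -, htab, hs, -, hgeo⟩ :=
      exists_contDiffOn_and_geodesic (n := n) hγ hmin (Ioo_subset_Icc_self ht) rfl
        (show u = _ from rfl)
    have h1 := hgeo t (htab ht) w
    have hz : u t ∈ (extChartAt (𝓡 n) (γ.extend t)).target :=
      (extChartAt (𝓡 n) (γ.extend t)).map_source (hs t (Ioo_subset_Icc_self (htab ht)))
    rw [christoffel, fderiv_chartMetric hz, fderiv_chartMetric hz, ← chartForm_apply]
    linarith

/-- Smoothness provides a velocity at every interior time, and the Lipschitz constant bounds its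
norm. -/
lemma length_le_of_lipschitzWith {γ : Path x y} {ℓ : ℝ≥0} (hγ : LipschitzWith ℓ γ)
    (hs : ContMDiffOn 𝓘(ℝ, ℝ) (𝓡 n) ∞ γ.extend (Icc 0 1)) : length (n := n) γ ≤ ℓ := by
  have hγe := lipschitzWith_extend hγ
  rw [length, Manifold.pathELength_eq_lintegral_mfderiv_Ioo]
  calc _ ≤ ∫⁻ t in Ioo (0 : ℝ) 1, (ℓ : ℝ≥0∞) := by
        refine setLIntegral_mono' measurableSet_Ioo fun t ht ↦ ?_
        have h1 : ContMDiffAt 𝓘(ℝ, ℝ) (𝓡 n) ∞ γ.extend t := hs.contMDiffAt (Icc_mem_nhds ht.1 ht.2)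
        have hsrc := mem_extChartAt_source (I := 𝓡 n) (γ.extend t)
        have h2 : HasDerivAt (fun s ↦ extChartAt (𝓡 n) (γ.extend t) (γ.extend s)) _ t :=
          ((contMDiffAt_iff_contDiffAt.1 ((contMDiffAt_extChartAt (x := γ.extend t)).comp t
            h1)).differentiableAt (by simp)).hasDerivAt
        have h3 := sqrt_chartForm_le_of_eventually_dist_le ℓ.2 (Eventually.of_forall fun s ↦ by
          rw [dist_comm]; exact hγe.dist_le_mul s t) hsrc h2
        rw [← norm_mfderiv_eq_sqrt_chartForm (c := γ.extend) h2
          ((extChartAt (𝓡 n) (γ.extend t)).map_source hsrc) (by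
            filter_upwards [hγe.continuous.continuousAt.preimage_mem_nhds
              (extChartAt_source_mem_nhds (I := 𝓡 n) (γ.extend t))] with s hs
            exact ((extChartAt (𝓡 n) (γ.extend t)).left_inv hs).symm)] at h3
        rw [← ofReal_norm, ← ENNReal.ofReal_coe_nnreal]
        exact ENNReal.ofReal_le_ofReal h3
    _ = ℓ := by simp

/-- A competitor of finite length bounds the length of its class by `LengthLE.of_isPiecewiseC1`, so
minimality among Lipschitz constants gives minimality of Riemannian length. -/
lemma minimizesLength_of_minimal {γ : Path x y} {ℓ : ℝ≥0} (hγ : LipschitzWith ℓ γ)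
    (hmin : ∀ L, LengthLE (.mk γ) L → ℓ ≤ L) : MinimizesLengthInHomotopyClass (n := n) γ := by
  intro c hc hcγ
  refine (length_le_of_lipschitzWith hγ (isGeodesic_of_minimal hγ hmin).1).trans ?_
  by_cases htop : length (n := n) c = ⊤
  · exact htop ▸ le_top
  have h := LengthLE.of_isPiecewiseC1 hc (ENNReal.coe_toNNReal htop).ge
  rw [Path.Homotopic.Quotient.eq.2 hcγ] at h
  exact (ENNReal.coe_le_coe.2 (hmin _ h)).trans_eq (ENNReal.coe_toNNReal htop)

end Minimizer

end RiemannianGeodesic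

/-! ### The theorem -/

open RiemannianGeodesic in
theorem proposition2 {n : ℕ} {M : Type*} [MetricSpace M]
    [ChartedSpace (EuclideanSpace ℝ (Fin n)) M] [IsManifold (𝓡 n) ∞ M]
    [RiemannianBundle (fun q : M ↦ TangentSpace (𝓡 n) q)]
    [IsContMDiffRiemannianBundle (𝓡 n) ∞ (EuclideanSpace ℝ (Fin n))
      (fun q : M ↦ TangentSpace (𝓡 n) q)]
    [IsRiemannianManifold (𝓡 n) M] [CompactSpace M] [ConnectedSpace M]
    (p : M) (hnontrivial : Nontrivial (FundamentalGroup M p))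
    (htorsionfree : ∀ g : FundamentalGroup M p, g ≠ 1 → ¬ IsOfFinOrder g)
    (x y : M) (k : ℕ) (hk : 1 ≤ k) :
    ∃ γ : Fin k → Path x y,
      Function.Injective γ ∧
      (∀ i, RiemannianGeodesic.IsGeodesic (n := n) (γ i)) ∧
      (∀ i, RiemannianGeodesic.length (n := n) (γ i) ≤
        ENNReal.ofReal (k * Metric.diam (Set.univ : Set M))) ∧
      (∀ i j, i ≠ j → ¬ (γ i).Homotopic (γ j)) ∧
      (∀ i, RiemannianGeodesic.MinimizesLengthInHomotopyClass (n := n) (γ i)) := by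
  obtain ⟨r, hr, hS⟩ := exists_smallPathsHomotopic n M
  have hL := hasShortPaths n M
  have : PathConnectedSpace M := ⟨⟨p⟩, fun a b ↦ ⟨(hL a b 1 one_pos).choose⟩⟩
  -- The hypotheses are at the base point `p`, whereas the loops are needed at `x`.
  let e := FundamentalGroup.fundamentalGroupMulEquivOfPathConnected (X := M) x p
  have : Nontrivial (FundamentalGroup M x) := e.toEquiv.nontrivial
  have htf : ∀ g : FundamentalGroup M x, g ≠ 1 → ¬ IsOfFinOrder g := fun g hg h ↦
    htorsionfree (e g) (e.map_ne_one_iff.2 hg) (e.toMonoidHom.isOfFinOrder h)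
  have hD : ∀ a b : M, nndist a b ≤ (Metric.diam (Set.univ : Set M)).toNNReal := fun a b ↦ by
    rw [← NNReal.coe_le_coe, coe_nndist, Real.coe_toNNReal _ Metric.diam_nonneg]
    exact Metric.dist_le_diam_of_mem isCompact_univ.isBounded trivial trivial
  obtain ⟨γ, ℓ, hhom, hℓ, hγ, hmin⟩ := exists_minimal_lipschitzWith hr hS hL hD x y htf k
  have hgeo : ∀ i, IsGeodesic (n := n) (γ i) := fun i ↦ isGeodesic_of_minimal (hγ i) (hmin i)
  refine ⟨γ, fun i j hij ↦ ?_, hgeo, fun i ↦ ?_, hhom,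
    fun i ↦ minimizesLength_of_minimal (hγ i) (hmin i)⟩
  · by_contra hne
    exact hhom i j hne (hij ▸ Path.Homotopic.refl _)
  · refine (length_le_of_lipschitzWith (hγ i) (hgeo i).1).trans ?_
    rw [← ENNReal.ofReal_coe_nnreal]
    refine ENNReal.ofReal_le_ofReal ((NNReal.coe_le_coe.2 (hℓ i)).trans_eq ?_)
    simp [Metric.diam_nonneg]

end
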